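/- Let $L>0$, let $V=H^2(0,L;\mathbb R^3)\times H^1(0,L;\mathbb R^3)$, and let $L_{\rm bc}:V\to W$ be a bounded linear operator into a normed space $W$ that depends only on the boundary values (at $0$ and $L$) of $y$, $y'$ and $b$; let $\ell_{\rm bc}\in W$. Put $$\mathcal A_{\rm frame}=\{(y,b)\in V:\ [y',b,y'\times b]\in SO(3)\ \text{a.e. in }(0,L),\ L_{\rm bc}[y,b]=\ell_{\rm bc}\}.$$ Let $\overline Q(\alpha,\beta)=(\alpha^2+\beta^2)^2/\alpha^2$ if $|\alpha|\ge|\beta|$ (read as $0$ at $\alpha=\beta=0$) and $\overline Q(\alpha,\beta)=4\beta^2$ if $|\alpha|\le|\beta|$. The constrained corrected Sadowsky functional $E:V\to[0,\infty]$ is $$E[y,b]=\int_0^L\overline Q(|y''|,|b'|)\,dx$$ if $(y,b)\in\mathcal A_{\rm frame}$ and $y'\cdot b'=0$ a.e. in $(0,L)$, and $E[y,b]=+\infty$ otherwise. For every $\delta\ge0$ let $|\cdot|_\delta:\mathbb R\to[0,\infty)$ be given such that, with constants $c_0,c_1,c_2,c_{\rm uni}>0$ independent of $\delta$, $|x|_\delta\ge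 c_0\delta$ and $\big||x|_\delta-|x|\big|\le c_{\rm uni}\delta$ for all $x\in\mathbb R$, $\delta\ge 0$, and for $\delta>0$ moreover $|\cdot|_\delta\in C^2(\mathbb R)$, $|\cdot|_\delta'\le c_1$, $|\cdot|_\delta''\le c_2\delta^{-1}$. Set $$\overline Q_\delta(\alpha,\beta)=2\beta^2+\tfrac12\alpha^2+\tfrac12\beta^2+\tfrac12|\alpha^2-\beta^2|_\delta+\frac{2\beta^4}{\alpha^2+\beta^2+|\alpha^2-\beta^2|_\delta}$$ (the last term is read as $0$ where its denominator vanishes). For a partitioning $\mathcal T$ of $[0,L]$ with nodes $0=x_0<\dots<x_N=L$ and maximal mesh-size $h$, let $\mathcal S^{p,k}(\mathcal T)$ be the space of functions in $C^k([0,L])$ that are polynomials of degree at most $p$ on each element. For $\varepsilon=(\varepsilon_1,\varepsilon_2)$, $\varepsilon_1,\varepsilon_2>0$, the constrained discrete functional $E_{\delta,\varepsilon,h}:V\to[0,\infty]$ is $$E_{\delta,\varepsilon,h}[y_h,b_h]=\int_0^L\overline Q_\delta(|y_h''|,|b_h'|)\,dx+\frac1{2\varepsilon_1}\int_0^L(y_h'\cdot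 b_h)^2\,dx+\frac1{2\varepsilon_2}\int_0^L(y_h'\cdot b_h')^2\,dx$$ if $(y_h,b_h)\in\mathcal S^{3,1}(\mathcal T)^3\times\mathcal S^{1,0}(\mathcal T)^3$, $|y_h'(x_j)|^2=|b_h(x_j)|^2=1$ for $j=0,\dots,N$ and $L_{\rm bc}[y_h,b_h]=\ell_{\rm bc}$, and $E_{\delta,\varepsilon,h}[y_h,b_h]=+\infty$ otherwise. Assume that for every $(y,b)\in\mathcal A_{\rm frame}$ with $y'\cdot b'=0$ and every $\sigma>0$ there is $(y_\sigma,b_\sigma)\in\mathcal A_{\rm frame}$ with $y_\sigma,b_\sigma\in C^\infty([0,L];\mathbb R^3)$, $y_\sigma'\cdot b_\sigma'=0$ in $(0,L)$ and $\|y-y_\sigma\|_{H^2(0,L)}+\|b-b_\sigma\|_{H^1(0,L)}\le\sigma$. Consider any sequence of partitionings with maximal mesh-sizes $h\to0$ that is quasiuniform (there is $c>0$ such that every element of every partitioning has length at least $c\,h$, with $h$ the maximal mesh-size of that partitioning), and corresponding parameters $\delta\ge0$, $\varepsilon_1,\varepsilon_2>0$ with $\delta,\varepsilon_1,\varepsilon_2\to0$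 and $$h^2\varepsilon_1^{-1}+h^2\varepsilon_2^{-1}\to0.$$ Then the functionals $E_{\delta,\varepsilon,h}$ are $\Gamma$-convergent to $E$ on $V$ in the following sense: (i) $E[y,b]\le\liminf E_{\delta,\varepsilon,h}[y_h,b_h]$ whenever $(y_h,b_h)\rightharpoonup(y,b)$ weakly in $V$; (ii) for every $(y,b)\in V$ there are $(y_h,b_h)\in V$ with $(y_h,b_h)\to(y,b)$ in the norm of $V$ and $\limsup E_{\delta,\varepsilon,h}[y_h,b_h]\le E[y,b]$. -/

import Mathlib

open MeasureTheory Filter Topology Set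
open scoped ContDiff Polynomial Matrix

noncomputable section

namespace Ribbon

/-! ### Sobolev spaces on the interval `(0, L)` -/

/-- Euclidean three-space. -/
abbrev E3 : Type := EuclideanSpace ℝ (Fin 3)

/-- Lebesgue measure on the open interval `(0, L)`. -/
abbrev mu (L : ℝ) : Measure ℝ := volume.restrict (Ioo 0 L)

/-- `L²(0, L; ℝ³)`. -/
abbrev L2 (L : ℝ) : Type := Lp E3 2 (mu L)

/-- Scalar test functions, i.e. the elements of `C_c^∞(0, L)`. -/
def IsTest (L : ℝ) (φ : ℝ → ℝ) : Prop :=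
  ContDiff ℝ ∞ φ ∧ HasCompactSupport φ ∧ tsupport φ ⊆ Ioo 0 L

/-- `v` is the weak derivative of `u` on `(0, L)`. -/
def IsWeakDeriv (L : ℝ) (u v : L2 L) : Prop :=
  ∀ φ : ℝ → ℝ, IsTest L φ →
    ∫ x in Ioo 0 L, deriv φ x • u x = -∫ x in Ioo 0 L, φ x • v x

theorem integrable_smul_L2 {L : ℝ} {g : ℝ → ℝ} (hg : Continuous g) (hc : HasCompactSupport g)
    (u : L2 L) : Integrable (fun x => g x • u x) (mu L) := by
  have hu : Integrable (fun x => u x) (mu L) := (Lp.memLp u).integrable (by norm_num)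
  obtain ⟨C, hC⟩ := hc.exists_bound_of_continuous hg
  exact hu.bdd_smul C hg.aestronglyMeasurable (Eventually.of_forall hC)

theorem IsTest.integrable {L : ℝ} {φ : ℝ → ℝ} (h : IsTest L φ) (u : L2 L) :
    Integrable (fun x => φ x • u x) (mu L) :=
  integrable_smul_L2 h.1.continuous h.2.1 u

theorem IsTest.integrable_deriv {L : ℝ} {φ : ℝ → ℝ} (h : IsTest L φ) (u : L2 L) :
    Integrable (fun x => deriv φ x • u x) (mu L) :=
  integrable_smul_L2 (h.1.continuous_deriv (by simp)) h.2.1.deriv u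

theorem integral_smul_add {L : ℝ} {g : ℝ → ℝ} (u v : L2 L)
    (hu : Integrable (fun x => g x • u x) (mu L)) (hv : Integrable (fun x => g x • v x) (mu L)) :
    ∫ x in Ioo 0 L, g x • (u + v : L2 L) x
      = (∫ x in Ioo 0 L, g x • u x) + ∫ x in Ioo 0 L, g x • v x := by
  rw [← integral_add hu hv]
  refine integral_congr_ae ?_
  filter_upwards [Lp.coeFn_add u v] with x hx
  rw [hx, Pi.add_apply, smul_add]

theorem integral_smul_smul {L : ℝ} {g : ℝ → ℝ} (c : ℝ) (u : L2 L) :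
    ∫ x in Ioo 0 L, g x • (c • u : L2 L) x = c • ∫ x in Ioo 0 L, g x • u x := by
  rw [← integral_smul]
  refine integral_congr_ae ?_
  filter_upwards [Lp.coeFn_smul c u] with x hx
  rw [hx, Pi.smul_apply, smul_comm]

theorem isWeakDeriv_zero (L : ℝ) : IsWeakDeriv L 0 0 := by
  intro φ _
  have h : ∀ g : ℝ → ℝ, ∫ x in Ioo 0 L, g x • (0 : L2 L) x = 0 := by
    intro g
    refine integral_eq_zero_of_ae ?_
    filter_upwards [Lp.coeFn_zero E3 2 (mu L)] with x hx
    rw [hx]; simp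
  rw [h, h, neg_zero]

theorem IsWeakDeriv.add {L : ℝ} {u v u' v' : L2 L} (h : IsWeakDeriv L u u')
    (k : IsWeakDeriv L v v') : IsWeakDeriv L (u + v) (u' + v') := by
  intro φ hφ
  rw [integral_smul_add u v (hφ.integrable_deriv u) (hφ.integrable_deriv v),
    integral_smul_add u' v' (hφ.integrable u') (hφ.integrable v'), h φ hφ, k φ hφ, neg_add]

theorem IsWeakDeriv.smul {L : ℝ} {u u' : L2 L} (c : ℝ) (h : IsWeakDeriv L u u') :
    IsWeakDeriv L (c • u) (c • u') := by
  intro φ hφ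
  rw [integral_smul_smul, integral_smul_smul, h φ hφ, smul_neg]

/-- The Sobolev space `H^k(0, L; ℝ³)`: a function is recorded with its weak derivatives
`(u, u', …, u^(k))`, all in `L²`.  The norm is the usual one,
`‖u‖² = ∑_{i ≤ k} ‖u^(i)‖²_{L²}`. -/
def Sobolev (L : ℝ) (k : ℕ) : Submodule ℝ (PiLp 2 (fun _ : Fin (k + 1) => L2 L)) where
  carrier := {u | ∀ i : Fin k, IsWeakDeriv L (u i.castSucc) (u i.succ)}
  zero_mem' := fun _ => isWeakDeriv_zero L
  add_mem' := fun hu hv i => (hu i).add (hv i)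
  smul_mem' := fun c _ hu i => (hu i).smul c

/-- The `i`-th weak derivative of `u ∈ H^k`, as a function defined up to null sets. -/
def wd {L : ℝ} {k : ℕ} (u : Sobolev L k) (i : Fin (k + 1)) : ℝ → E3 :=
  fun x => (u : PiLp 2 (fun _ : Fin (k + 1) => L2 L)) i x

/-- `V = H²(0, L; ℝ³) × H¹(0, L; ℝ³)`; an element is a pair `v = (y, b)`. -/
abbrev V (L : ℝ) : Type := Sobolev L 2 × Sobolev L 1

/-- `(Y, B)` is the representative of `(y, b) ∈ V` with `Y ∈ C¹([0, L])` and `B ∈ C⁰([0, L])`.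
By the Sobolev embedding it exists, and it is unique on `[0, L]`. -/
structure IsRep {L : ℝ} (v : V L) (Y B : ℝ → E3) : Prop where
  contDiffOn : ContDiffOn ℝ 1 Y (Icc 0 L)
  continuousOn : ContinuousOn B (Icc 0 L)
  ae_eq_y : Y =ᵐ[mu L] wd v.1 0
  ae_eq_b : B =ᵐ[mu L] wd v.2 0

/-- The classical derivative on `[0, L]` (one-sided at the two end points). -/
def der (L : ℝ) (Y : ℝ → E3) : ℝ → E3 := derivWithin Y (Icc 0 L)

/-- The operator `Lbc` depends only on the boundary values of `y`, `y'` and `b`. -/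
def DependsOnlyOnBoundary {L : ℝ} {W : Type*} [NormedAddCommGroup W] [NormedSpace ℝ W]
    (Lbc : V L →L[ℝ] W) : Prop :=
  ∀ (v w : V L) (Y B Z C : ℝ → E3), IsRep v Y B → IsRep w Z C →
    (∀ x ∈ ({0, L} : Set ℝ), Y x = Z x ∧ der L Y x = der L Z x ∧ B x = C x) → Lbc v = Lbc w

/-! ### The energy densities -/

/-- The corrected Sadowsky energy density. -/
def Qbar (α β : ℝ) : ℝ :=
  if |β| ≤ |α| then (α ^ 2 + β ^ 2) ^ 2 / α ^ 2 else 4 * β ^ 2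

/-- `m δ x` is a regularized modulus `|x|_δ` with constants `c₀, c₁, c₂, c_uni`.  For `δ = 0` the
last condition forces `|x|_0 = |x|`, so that differentiability is required for `δ > 0` only. -/
structure IsRegModulus (m : ℝ → ℝ → ℝ) (c₀ c₁ c₂ cuni : ℝ) : Prop where
  contDiff : ∀ δ, 0 < δ → ContDiff ℝ 2 (m δ)
  nonneg : ∀ δ, 0 ≤ δ → ∀ x, 0 ≤ m δ x
  lower : ∀ δ, 0 ≤ δ → ∀ x, c₀ * δ ≤ m δ x
  deriv_le : ∀ δ, 0 < δ → ∀ x, deriv (m δ) x ≤ c₁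
  deriv2_le : ∀ δ, 0 < δ → ∀ x, deriv (deriv (m δ)) x ≤ c₂ * δ⁻¹
  unif : ∀ δ, 0 ≤ δ → ∀ x, |m δ x - abs x| ≤ cuni * δ

/-- The regularized density `Q̄_δ`, for the regularized modulus `r = |·|_δ`. -/
def Qreg (r : ℝ → ℝ) (α β : ℝ) : ℝ :=
  2 * β ^ 2 + 1 / 2 * α ^ 2 + 1 / 2 * β ^ 2 + 1 / 2 * r (α ^ 2 - β ^ 2)
    + 2 * β ^ 4 / (α ^ 2 + β ^ 2 + r (α ^ 2 - β ^ 2))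

/-! ### The continuous functional -/

/-- The matrix with columns `t`, `b`, `t × b`. -/
def frameMatrix (t b : E3) : Matrix (Fin 3) (Fin 3) ℝ :=
  (Matrix.of ![t.ofLp, b.ofLp, t.ofLp ⨯₃ b.ofLp])ᵀ

/-- The set of admissible frames: `[y', b, y' × b] ∈ SO(3)` almost everywhere and
`Lbc[y, b] = ℓbc`. -/
def AFrame {L : ℝ} {W : Type*} [NormedAddCommGroup W] [NormedSpace ℝ W]
    (Lbc : V L →L[ℝ] W) (lbc : W) : Set (V L) :=
  {v | (∀ᵐ x ∂(mu L), frameMatrix (wd v.1 1 x) (wd v.2 0 x)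
      ∈ Matrix.specialOrthogonalGroup (Fin 3) ℝ) ∧ Lbc v = lbc}

/-- The constraint `y' · b' = 0` almost everywhere in `(0, L)`. -/
def NoInplaneCurvature {L : ℝ} (v : V L) : Prop :=
  ∀ᵐ x ∂(mu L), inner ℝ (wd v.1 1 x) (wd v.2 1 x) = 0

/-- `y` and `b` are infinitely differentiable on `[0, L]`. -/
def IsSmooth {L : ℝ} (v : V L) : Prop :=
  ∃ Y B : ℝ → E3, IsRep v Y B ∧ ContDiffOn ℝ ∞ Y (Icc 0 L) ∧ ContDiffOn ℝ ∞ B (Icc 0 L)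

/-- `E[y, b] = ∫₀ᴸ Q̄(|y''|, |b'|) dx`. -/
def energy {L : ℝ} (v : V L) : ℝ :=
  ∫ x in Ioo 0 L, Qbar ‖wd v.1 2 x‖ ‖wd v.2 1 x‖

open Classical in
/-- The constrained corrected Sadowsky functional on `V`, with value `+∞` off the admissible
frames with `y' · b' = 0`. -/
def constrainedEnergy {L : ℝ} {W : Type*} [NormedAddCommGroup W] [NormedSpace ℝ W]
    (Lbc : V L →L[ℝ] W) (lbc : W) (v : V L) : EReal :=
  if v ∈ AFrame Lbc lbc ∧ NoInplaneCurvature v then ((energy v : ℝ) : EReal) else ⊤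

/-! ### The discrete functionals -/

/-- A partitioning `0 = x₀ < x₁ < ⋯ < x_N = L`. -/
structure Mesh (L : ℝ) where
  N : ℕ
  node : Fin (N + 1) → ℝ
  strictMono : StrictMono node
  node_zero : node 0 = 0
  node_last : node (Fin.last N) = L

/-- The length of the `j`-th element. -/
def Mesh.elemSize {L : ℝ} (T : Mesh L) (j : Fin T.N) : ℝ := T.node j.succ - T.node j.castSucc

/-- The maximal mesh-size `h`. -/
def Mesh.size {L : ℝ} (T : Mesh L) : ℝ := ⨆ j : Fin T.N, T.elemSize j

/-- The space `S^{p,k}(T)` of `C^k` functions on `[0, L]` that are elementwise polynomials of degree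
at most `p`. -/
def Mesh.spline {L : ℝ} (T : Mesh L) (p k : ℕ) : Set (ℝ → ℝ) :=
  {f | ContDiffOn ℝ k f (Icc 0 L) ∧ ∀ j : Fin T.N, ∃ q : ℝ[X], q.natDegree ≤ p ∧
    ∀ x ∈ Icc (T.node j.castSucc) (T.node j.succ), f x = q.eval x}

/-- The admissible discrete pairs: `(y_h, b_h) ∈ S^{3,1}(T)³ × S^{1,0}(T)³` with `|y_h'| = |b_h| = 1`
at the nodes and `Lbc[y_h, b_h] = ℓbc`. -/
def discreteAdmissible {L : ℝ} {W : Type*} [NormedAddCommGroup W] [NormedSpace ℝ W]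
    (Lbc : V L →L[ℝ] W) (lbc : W) (T : Mesh L) : Set (V L) :=
  {v | (∃ Y B : ℝ → E3, IsRep v Y B ∧
      (∀ i : Fin 3, (fun x => Y x i) ∈ T.spline 3 1) ∧
      (∀ i : Fin 3, (fun x => B x i) ∈ T.spline 1 0) ∧
      ∀ j, ‖der L Y (T.node j)‖ ^ 2 = 1 ∧ ‖B (T.node j)‖ ^ 2 = 1) ∧ Lbc v = lbc}

/-- `∫₀ᴸ Q̄_δ(|y''|, |b'|) dx + (2 ε₁)⁻¹ ∫₀ᴸ (y' · b)² dx + (2 ε₂)⁻¹ ∫₀ᴸ (y' · b')² dx`,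
with `r = |·|_δ`. -/
def penalizedEnergy {L : ℝ} (r : ℝ → ℝ) (ε₁ ε₂ : ℝ) (v : V L) : ℝ :=
  (∫ x in Ioo 0 L, Qreg r ‖wd v.1 2 x‖ ‖wd v.2 1 x‖)
    + 1 / (2 * ε₁) * (∫ x in Ioo 0 L, (inner ℝ (wd v.1 1 x) (wd v.2 0 x)) ^ 2)
    + 1 / (2 * ε₂) * ∫ x in Ioo 0 L, (inner ℝ (wd v.1 1 x) (wd v.2 1 x)) ^ 2

open Classical in
/-- The constrained discrete functional on `V`, with value `+∞` off the admissible discrete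
pairs. -/
def discreteEnergy {L : ℝ} {W : Type*} [NormedAddCommGroup W] [NormedSpace ℝ W]
    (Lbc : V L →L[ℝ] W) (lbc : W) (T : Mesh L) (r : ℝ → ℝ) (ε₁ ε₂ : ℝ) (v : V L) : EReal :=
  if v ∈ discreteAdmissible Lbc lbc T then ((penalizedEnergy r ε₁ ε₂ v : ℝ) : EReal) else ⊤

/-! ### Γ-convergence -/

/-- Γ-convergence of `F n` to `F₀`: the liminf inequality holds along all weakly convergent
sequences, and there are recovery sequences that converge even in norm.  In particular there is
sequential Γ-convergence both in the weak and in the norm topology. -/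
def GammaConverges {X : Type*} [NormedAddCommGroup X] [NormedSpace ℝ X]
    (F : ℕ → X → EReal) (F₀ : X → EReal) : Prop :=
  (∀ (u : ℕ → X) (u₀ : X),
      Tendsto (fun n => toWeakSpace ℝ X (u n)) atTop (𝓝 (toWeakSpace ℝ X u₀)) →
      F₀ u₀ ≤ liminf (fun n => F n (u n)) atTop) ∧
  (∀ u₀ : X, ∃ u : ℕ → X, Tendsto u atTop (𝓝 u₀) ∧
      limsup (fun n => F n (u n)) atTop ≤ F₀ u₀)

end Ribbon

end

noncomputable section

namespace Ribbon

/-! ### The energy densities -/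

/-- The ratio `|β| / |α|`, truncated at one. -/
def slope (α β : ℝ) : ℝ := if |β| ≤ |α| then β / α else 1

theorem slope_nonneg {α β : ℝ} (hα : 0 ≤ α) (hβ : 0 ≤ β) : 0 ≤ slope α β := by
  unfold slope; split_ifs <;> positivity

theorem slope_le_one {α β : ℝ} (hα : 0 ≤ α) (hβ : 0 ≤ β) : slope α β ≤ 1 := by
  unfold slope
  split_ifs with h
  · rw [abs_of_nonneg hα, abs_of_nonneg hβ] at h
    exact div_le_one_of_le₀ h hα
  · exact le_rfl

theorem Qbar_cases {α β : ℝ} (hα : 0 ≤ α) (hβ : 0 ≤ β) :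
    (β = slope α β * α ∧ Qbar α β = (α * (1 + slope α β ^ 2)) ^ 2) ∨
      (α ≤ β ∧ slope α β = 1 ∧ Qbar α β = 4 * β ^ 2) := by
  unfold slope Qbar
  rw [abs_of_nonneg hα, abs_of_nonneg hβ]
  split_ifs with h
  · left
    rcases hα.eq_or_lt with rfl | hα'
    · have : β = 0 := le_antisymm h hβ
      subst this; simp
    · constructor
      · field_simp
      · field_simp
  · right
    exact ⟨(not_le.mp h).le, rfl, rfl⟩

theorem Qbar_self {α β : ℝ} (hα : 0 ≤ α) (hβ : 0 ≤ β) :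
    2 * Qbar α β = 2 * (1 - slope α β ^ 4) * α ^ 2 + 4 * (1 + slope α β ^ 2) * β ^ 2 := by
  rcases Qbar_cases hα hβ with ⟨h1, h2⟩ | ⟨h1, h2, h3⟩
  · rw [h2]
    generalize slope α β = s at *
    subst h1; ring
  · rw [h3, h2]; ring

theorem Qbar_nonneg (α β : ℝ) : 0 ≤ Qbar α β := by
  unfold Qbar; split_ifs <;> positivity

theorem Qbar_le {α β : ℝ} (hα : 0 ≤ α) (hβ : 0 ≤ β) : Qbar α β ≤ α ^ 2 + 4 * β ^ 2 := by
  have h := Qbar_self hα hβ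
  have h0 := slope_nonneg hα hβ
  have h1 := slope_le_one hα hβ
  generalize slope α β = s at *
  have h2 : s ^ 2 ≤ 1 := pow_le_one₀ h0 h1
  have h3 : 0 ≤ s ^ 4 := by positivity
  have := mul_nonneg h3 (sq_nonneg α)
  have := mul_nonneg (sub_nonneg.mpr h2) (sq_nonneg β)
  linarith

/-- The dual representation of the density: `√Q̄(α, β) ≥ (1 - s²) α + 2 s β` for `s ∈ [0, 1]`. -/
theorem sq_le_Qbar {α β s : ℝ} (hα : 0 ≤ α) (hβ : 0 ≤ β) (hs : 0 ≤ s) (hs1 : s ≤ 1) :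
    ((1 - s ^ 2) * α + 2 * s * β) ^ 2 ≤ Qbar α β := by
  have hs2 : 0 ≤ 1 - s ^ 2 := by nlinarith
  rcases Qbar_cases hα hβ with ⟨h1, h2⟩ | ⟨h1, h2, h3⟩
  · rw [h2]
    have := slope_nonneg hα hβ
    generalize slope α β = t at *
    apply pow_le_pow_left₀ (by positivity)
    subst h1
    nlinarith [mul_nonneg hα (sq_nonneg (t - s))]
  · rw [h3, show 4 * β ^ 2 = (2 * β) ^ 2 by ring]
    apply pow_le_pow_left₀ (by positivity)
    nlinarith [mul_nonneg hs2 (sub_nonneg.mpr h1), mul_nonneg hβ (sq_nonneg (1 - s))]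

theorem Qbar_add_Qbar_ge {α β α' β' : ℝ} (hα : 0 ≤ α) (hβ : 0 ≤ β) (hα' : 0 ≤ α') (hβ' : 0 ≤ β') :
    2 * (1 - slope α β ^ 4) * (α * α') + 4 * (1 + slope α β ^ 2) * (β * β')
      ≤ Qbar α β + Qbar α' β' := by
  have h := sq_le_Qbar hα' hβ' (slope_nonneg hα hβ) (slope_le_one hα hβ)
  rcases Qbar_cases hα hβ with ⟨h1, h2⟩ | ⟨h1, h2, h3⟩
  · rw [h2]
    generalize slope α β = s at *
    subst h1
    nlinarith [sq_nonneg (α * (1 + s ^ 2) - ((1 - s ^ 2) * α' + 2 * s * β'))]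
  · rw [h3]
    rw [h2] at h ⊢
    nlinarith [sq_nonneg (2 * β - 2 * β')]

/-- The density `Q̄(|a|, |b|)` on pairs of vectors lies above its tangent planes. -/
theorem Qbar_tangent {H : Type*} [NormedAddCommGroup H] [InnerProductSpace ℝ H] (a b a' b' : H) :
    Qbar ‖a‖ ‖b‖ + (inner ℝ ((2 * (1 - slope ‖a‖ ‖b‖ ^ 4)) • a) (a' - a)
      + inner ℝ ((4 * (1 + slope ‖a‖ ‖b‖ ^ 2)) • b) (b' - b)) ≤ Qbar ‖a'‖ ‖b'‖ := by
  have h1 := Qbar_self (norm_nonneg a) (norm_nonneg b)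
  have h2 := Qbar_add_Qbar_ge (norm_nonneg a) (norm_nonneg b) (norm_nonneg a') (norm_nonneg b')
  have h3 := slope_nonneg (norm_nonneg a) (norm_nonneg b)
  have h4 := slope_le_one (norm_nonneg a) (norm_nonneg b)
  simp only [inner_smul_left, inner_sub_right, real_inner_self_eq_norm_sq, RCLike.conj_to_real]
  generalize slope ‖a‖ ‖b‖ = s at *
  have h5 : 0 ≤ 1 - s ^ 4 := sub_nonneg.mpr (pow_le_one₀ h3 h4)
  have h6 : 0 ≤ 1 + s ^ 2 := by positivity
  have := mul_le_mul_of_nonneg_left (real_inner_le_norm a a') h5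
  have := mul_le_mul_of_nonneg_left (real_inner_le_norm b b') h6
  nlinarith

theorem measurable_slope : Measurable (fun p : ℝ × ℝ => slope p.1 p.2) := by
  unfold slope
  refine Measurable.ite (measurableSet_le (by fun_prop) (by fun_prop)) (by fun_prop) (by fun_prop)

theorem measurable_Qbar : Measurable (fun p : ℝ × ℝ => Qbar p.1 p.2) := by
  unfold Qbar
  refine Measurable.ite (measurableSet_le (by fun_prop) (by fun_prop)) (by fun_prop) (by fun_prop)

theorem Qreg_abs (α β : ℝ) : Qreg (fun x => |x|) α β = Qbar α β := by
  unfold Qreg Qbar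
  split_ifs with h
  · have h2 := sq_le_sq.mpr h
    simp only [abs_of_nonneg (sub_nonneg.mpr h2)]
    by_cases h0 : α = 0
    · subst h0
      have : β = 0 := by simpa using h
      subst this; simp
    · field_simp
      rw [show α ^ 2 + β ^ 2 + (α ^ 2 - β ^ 2) = 2 * α ^ 2 by ring]
      field_simp
      ring
  · have h2 := (sq_lt_sq.mpr (not_le.mp h))
    simp only [abs_of_nonpos (sub_nonpos.mpr h2.le)]
    have h0 : β ≠ 0 := by
      rintro rfl
      simp at h
    rw [show α ^ 2 + β ^ 2 + -(α ^ 2 - β ^ 2) = 2 * β ^ 2 by ring]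
    field_simp
    ring

theorem abs_Qreg_sub_Qbar_le {r : ℝ → ℝ} {η : ℝ} (h0 : ∀ x, 0 ≤ r x) (h : ∀ x, |r x - abs x| ≤ η)
    (α β : ℝ) : |Qreg r α β - Qbar α β| ≤ 5 / 2 * η := by
  rw [← Qreg_abs]
  unfold Qreg
  have h1 := h (α ^ 2 - β ^ 2)
  have h2 := h0 (α ^ 2 - β ^ 2)
  have h3 := abs_nonneg (α ^ 2 - β ^ 2)
  simp only
  generalize r (α ^ 2 - β ^ 2) = x at *
  generalize |α ^ 2 - β ^ 2| = z at *
  have key : |2 * β ^ 4 / (α ^ 2 + β ^ 2 + x) - 2 * β ^ 4 / (α ^ 2 + β ^ 2 + z)| ≤ 2 * η := by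
    by_cases hb : β = 0
    · subst hb; simpa using (abs_nonneg _).trans h1
    · have hb2 : 0 < β ^ 2 := by positivity
      have ha2 := sq_nonneg α
      have p1 : 0 < α ^ 2 + β ^ 2 + x := by positivity
      have p2 : 0 < α ^ 2 + β ^ 2 + z := by positivity
      rw [div_sub_div _ _ p1.ne' p2.ne', abs_div, abs_of_pos (mul_pos p1 p2),
        div_le_iff₀ (mul_pos p1 p2),
        show 2 * β ^ 4 * (α ^ 2 + β ^ 2 + z) - (α ^ 2 + β ^ 2 + x) * (2 * β ^ 4)
          = -(2 * β ^ 4 * (x - z)) by ring, abs_neg, abs_mul, abs_of_nonneg (by positivity)]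
      have : β ^ 4 ≤ (α ^ 2 + β ^ 2 + x) * (α ^ 2 + β ^ 2 + z) := by
        rw [show β ^ 4 = β ^ 2 * β ^ 2 by ring]
        gcongr <;> linarith
      nlinarith [mul_le_mul_of_nonneg_left h1 (by positivity : 0 ≤ β ^ 4),
        mul_le_mul_of_nonneg_left this ((abs_nonneg _).trans h1)]
  rw [abs_le] at *
  constructor <;> linarith [key.1, key.2, h1.1, h1.2]

theorem measurable_Qreg {r : ℝ → ℝ} (hr : Measurable r) :
    Measurable (fun p : ℝ × ℝ => Qreg r p.1 p.2) := by
  unfold Qreg; fun_prop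

theorem IsRegModulus.measurable {m : ℝ → ℝ → ℝ} {c₀ c₁ c₂ cuni : ℝ}
    (hm : IsRegModulus m c₀ c₁ c₂ cuni) {δ : ℝ} (hδ : 0 ≤ δ) : Measurable (m δ) := by
  rcases hδ.eq_or_lt with rfl | h
  · have : m 0 = fun x => |x| := by
      funext x
      have := hm.unif 0 le_rfl x
      simp only [mul_zero, abs_nonpos_iff, sub_eq_zero] at this
      exact this
    rw [this]; fun_prop
  · exact (hm.contDiff δ h).continuous.measurable

/-! ### Orthonormal frames -/

theorem frameMatrix_mem_iff (t b : E3) :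
    frameMatrix t b ∈ Matrix.specialOrthogonalGroup (Fin 3) ℝ ↔
      ‖t‖ = 1 ∧ ‖b‖ = 1 ∧ inner ℝ t b = 0 := by
  have e1 : ‖t‖ = 1 ↔ t 0 * t 0 + t 1 * t 1 + t 2 * t 2 = 1 := by
    rw [← pow_eq_one_iff_of_nonneg (norm_nonneg t) two_ne_zero, EuclideanSpace.real_norm_sq_eq]
    simp [Fin.sum_univ_three, sq]
  have e2 : ‖b‖ = 1 ↔ b 0 * b 0 + b 1 * b 1 + b 2 * b 2 = 1 := by
    rw [← pow_eq_one_iff_of_nonneg (norm_nonneg b) two_ne_zero, EuclideanSpace.real_norm_sq_eq]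
    simp [Fin.sum_univ_three, sq]
  have e3 : inner ℝ t b = t 0 * b 0 + t 1 * b 1 + t 2 * b 2 := by
    simp [PiLp.inner_apply, Fin.sum_univ_three, mul_comm]
  rw [e1, e2, e3, Matrix.mem_specialOrthogonalGroup_iff, Matrix.mem_orthogonalGroup_iff']
  have ed : (frameMatrix t b).det = (t 1 * b 2 - t 2 * b 1) ^ 2 + (t 2 * b 0 - t 0 * b 2) ^ 2
      + (t 0 * b 1 - t 1 * b 0) ^ 2 := by
    simp [frameMatrix, Matrix.det_fin_three, cross_apply]
    ring
  have hl : (t 1 * b 2 - t 2 * b 1) ^ 2 + (t 2 * b 0 - t 0 * b 2) ^ 2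
      + (t 0 * b 1 - t 1 * b 0) ^ 2 = (t 0 * t 0 + t 1 * t 1 + t 2 * t 2) *
        (b 0 * b 0 + b 1 * b 1 + b 2 * b 2) - (t 0 * b 0 + t 1 * b 1 + t 2 * b 2) ^ 2 := by ring
  rw [ed, hl]
  constructor
  · rintro ⟨h, -⟩
    have h00 := congrFun (congrFun h 0) 0
    have h11 := congrFun (congrFun h 1) 1
    have h01 := congrFun (congrFun h 0) 1
    simp [frameMatrix, Matrix.mul_apply, Fin.sum_univ_three, cross_apply] at h00 h11 h01
    exact ⟨h00, h11, h01⟩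
  · rintro ⟨h1, h2, h3⟩
    refine ⟨?_, by rw [h1, h2, h3]; norm_num⟩
    ext i j
    fin_cases i <;> fin_cases j <;>
      simp [frameMatrix, Matrix.mul_apply, Fin.sum_univ_three, cross_apply] <;>
      first
      | linarith
      | (ring_nf; done)
      | (rw [h1, h2, h3] at hl; linarith)

/-! ### One-dimensional Sobolev functions -/

theorem L2_integrable {L : ℝ} (v : L2 L) : Integrable (fun x => v x) (mu L) :=
  (Lp.memLp v).integrable (by norm_num)

theorem integral_mu {F : Type*} [NormedAddCommGroup F] [NormedSpace ℝ F] {L : ℝ} (hL : 0 ≤ L)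
    (f : ℝ → F) : ∫ x, f x ∂(mu L) = ∫ x in (0 : ℝ)..L, f x := by
  rw [intervalIntegral.integral_of_le hL, integral_Ioc_eq_integral_Ioo]

theorem intervalIntegrable_of_mu {F : Type*} [NormedAddCommGroup F] {L : ℝ} {f : ℝ → F}
    (h : Integrable f (mu L)) (hL : 0 ≤ L) : IntervalIntegrable f volume 0 L :=
  (intervalIntegrable_iff_integrableOn_Ioo_of_le hL).mpr h

theorem intervalIntegrable_sub {F : Type*} [NormedAddCommGroup F] {L a b : ℝ} {f : ℝ → F}
    (h : Integrable f (mu L)) (ha : a ∈ Icc 0 L) (hb : b ∈ Icc 0 L) :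
    IntervalIntegrable f volume a b := by
  have hL : 0 ≤ L := ha.1.trans ha.2
  refine (intervalIntegrable_of_mu h hL).mono_set ?_
  rw [uIcc_of_le hL]
  exact uIcc_subset_Icc ha hb

theorem IsTest.zero_left {L : ℝ} {φ : ℝ → ℝ} (h : IsTest L φ) : φ 0 = 0 :=
  image_eq_zero_of_notMem_tsupport fun hx => lt_irrefl _ (h.2.2 hx).1

theorem IsTest.zero_right {L : ℝ} {φ : ℝ → ℝ} (h : IsTest L φ) : φ L = 0 :=
  image_eq_zero_of_notMem_tsupport fun hx => lt_irrefl _ (h.2.2 hx).2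

/-- The primitive `x ↦ ∫₀ˣ v`. -/
def prim (v : ℝ → E3) (x : ℝ) : E3 := ∫ t in (0 : ℝ)..x, v t

theorem prim_sub {L : ℝ} {v : ℝ → E3} (hv : Integrable v (mu L)) {a b : ℝ} (ha : a ∈ Icc 0 L)
    (hb : b ∈ Icc 0 L) : prim v b - prim v a = ∫ t in a..b, v t := by
  have h0 : (0 : ℝ) ∈ Icc 0 L := ⟨le_rfl, ha.1.trans ha.2⟩
  exact intervalIntegral.integral_interval_sub_left (intervalIntegrable_sub hv h0 hb)
    (intervalIntegrable_sub hv h0 ha)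

theorem continuousOn_prim {L : ℝ} (hL : 0 ≤ L) {v : ℝ → E3} (hv : Integrable v (mu L)) :
    ContinuousOn (prim v) (Icc 0 L) := by
  have h := intervalIntegral.continuousOn_primitive_interval (μ := volume) (f := v) (a := 0) (b := L)
    ((intervalIntegrable_iff' (by simp)).mp (intervalIntegrable_of_mu hv hL))
  rwa [uIcc_of_le hL] at h

theorem norm_prim_le {L : ℝ} {v : ℝ → E3} (hv : Integrable v (mu L)) {x : ℝ}
    (hx : x ∈ Icc 0 L) : ‖prim v x‖ ≤ ∫ t, ‖v t‖ ∂(mu L) := by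
  have hL : 0 ≤ L := hx.1.trans hx.2
  rw [integral_mu hL]
  refine (intervalIntegral.norm_integral_le_integral_norm hx.1).trans ?_
  refine intervalIntegral.integral_mono_interval le_rfl hx.1 hx.2
    (Eventually.of_forall fun _ => norm_nonneg _) (intervalIntegrable_of_mu hv hL).norm

theorem prim_coord {L : ℝ} {v : ℝ → E3} (hv : Integrable v (mu L)) {x : ℝ} (hx : x ∈ Icc 0 L)
    (i : Fin 3) : prim v x i = ∫ t in (0 : ℝ)..x, v t i :=
  (ContinuousLinearMap.intervalIntegral_comp_comm (EuclideanSpace.proj (𝕜 := ℝ) i)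
    (intervalIntegrable_sub hv ⟨le_rfl, hx.1.trans hx.2⟩ hx)).symm

theorem integral_coord {μ : Measure ℝ} {f : ℝ → E3} (hf : Integrable f μ) (i : Fin 3) :
    (∫ x, f x ∂μ) i = ∫ x, f x i ∂μ :=
  (ContinuousLinearMap.integral_comp_comm (EuclideanSpace.proj (𝕜 := ℝ) i) hf).symm

theorem Integrable.coord {μ : Measure ℝ} {f : ℝ → E3} (hf : Integrable f μ) (i : Fin 3) :
    Integrable (fun x => f x i) μ :=
  (EuclideanSpace.proj (𝕜 := ℝ) i : E3 →L[ℝ] ℝ).integrable_comp hf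

theorem integrable_of_continuousOn {F : Type*} [NormedAddCommGroup F] {L : ℝ} {f : ℝ → F}
    (hf : ContinuousOn f (Icc 0 L)) : Integrable f (mu L) :=
  (hf.integrableOn_compact isCompact_Icc).mono_set Ioo_subset_Icc_self

/-- Integration by parts against a primitive. -/
theorem integral_deriv_smul_prim {L : ℝ} (hL : 0 < L) (v : L2 L) {φ : ℝ → ℝ} (hφ : IsTest L φ) :
    ∫ x in Ioo 0 L, deriv φ x • prim v x = -∫ x in Ioo 0 L, φ x • v x := by
  have hv := L2_integrable v
  have hd : Continuous (deriv φ) := hφ.1.continuous_deriv (by simp)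
  have hP : ContinuousOn (prim v) (Icc 0 L) := continuousOn_prim hL.le hv
  have h1 : Integrable (fun x => deriv φ x • prim v x) (mu L) :=
    integrable_of_continuousOn (hd.continuousOn.smul hP)
  ext i
  rw [integral_coord h1, PiLp.neg_apply, integral_coord (hφ.integrable v)]
  simp only [PiLp.smul_apply, smul_eq_mul]
  have hvi : IntervalIntegrable (fun t => v t i) volume 0 L :=
    intervalIntegrable_of_mu (Integrable.coord hv i) hL.le
  have hac := hvi.absolutelyContinuousOnInterval_intervalIntegral (c := 0) (by simp)
  have hφac : AbsolutelyContinuousOnInterval φ 0 L :=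
    (hφ.1.of_le (by simp)).contDiffOn.absolutelyContinuousOnInterval
  have key := hφac.integral_mul_deriv_eq_deriv_mul hac
  rw [hφ.zero_left, hφ.zero_right] at key
  simp only [zero_mul, sub_zero, zero_sub] at key
  rw [integral_mu hL.le, integral_mu hL.le]
  have e1 : ∫ x in (0 : ℝ)..L, deriv φ x * prim v x i
      = ∫ x in (0 : ℝ)..L, deriv φ x * ∫ t in (0 : ℝ)..x, v t i := by
    refine intervalIntegral.integral_congr fun x hx => ?_
    rw [uIcc_of_le hL.le] at hx
    simp only [prim_coord hv hx]
  have e2 : ∫ x in (0 : ℝ)..L, φ x * deriv (fun x => ∫ t in (0 : ℝ)..x, v t i) x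
      = ∫ x in (0 : ℝ)..L, φ x * v x i := by
    refine intervalIntegral.integral_congr_ae ?_
    filter_upwards [hvi.ae_hasDerivAt_integral] with x hx hx'
    rw [(hx (uIoc_subset_uIcc hx') 0 (by simp)).deriv]
  rw [e1, ← e2, key, neg_neg]

theorem ae_mem_mu (L : ℝ) : ∀ᵐ x ∂(mu L), x ∈ Ioo 0 L := ae_restrict_mem measurableSet_Ioo

/-- The fundamental lemma of the calculus of variations. -/
theorem ae_eq_of_forall_test {L : ℝ} {f g : ℝ → E3} (hf : Integrable f (mu L))
    (hg : Integrable g (mu L))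
    (h : ∀ φ, IsTest L φ → ∫ x in Ioo 0 L, φ x • f x = ∫ x in Ioo 0 L, φ x • g x) :
    f =ᵐ[mu L] g := by
  have hfg : IntegrableOn (fun x => f x - g x) (Ioo 0 L) := hf.sub hg
  have key := isOpen_Ioo.ae_eq_zero_of_integral_contDiff_smul_eq_zero
    (hfg.locallyIntegrableOn) (fun φ h1 h2 h3 => by
      have hb : ∀ u : ℝ → E3, Integrable u (mu L) → Integrable (fun x => φ x • u x) (mu L) := by
        intro u hu
        obtain ⟨C, hC⟩ := h2.exists_bound_of_continuous h1.continuous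
        exact hu.bdd_smul C h1.continuous.aestronglyMeasurable (Eventually.of_forall hC)
      have h4 := h φ ⟨h1, h2, h3⟩
      rw [← sub_eq_zero, ← integral_sub (hb f hf) (hb g hg)] at h4
      rw [← h4, ← integral_indicator measurableSet_Ioo]
      refine integral_congr_ae (Eventually.of_forall fun x => ?_)
      by_cases hx : x ∈ Ioo 0 L
      · simp only [indicator_of_mem hx, smul_sub]
      · have : φ x = 0 := image_eq_zero_of_notMem_tsupport fun hx' => hx (h3 hx')
        simp only [indicator_of_notMem hx, this, zero_smul])
  refine (ae_restrict_iff' measurableSet_Ioo).mpr ?_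
  filter_upwards [key] with x hx hx'
  exact sub_eq_zero.mp (hx hx')

/-- A test function with vanishing integral has a primitive that is a test function. -/
theorem exists_test_primitive {L : ℝ} {ψ : ℝ → ℝ} (hψ : IsTest L ψ)
    (h0 : ∫ x in (0 : ℝ)..L, ψ x = 0) : ∃ φ, IsTest L φ ∧ deriv φ = ψ := by
  rcases (tsupport ψ).eq_empty_or_nonempty with he | hne
  · have : ψ = 0 := tsupport_eq_empty_iff.mp he
    exact ⟨ψ, hψ, by rw [this]; ext x; simp⟩
  have hcomp : IsCompact (tsupport ψ) := hψ.2.1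
  obtain ⟨a, ha, ha'⟩ := hcomp.exists_isLeast hne
  obtain ⟨b, hb, hb'⟩ := hcomp.exists_isGreatest hne
  have ha0 := hψ.2.2 ha
  have hb0 := hψ.2.2 hb
  have hzl : ∀ x, x < a → ψ x = 0 := fun x hx =>
    image_eq_zero_of_notMem_tsupport fun hx' => absurd (ha' hx') (not_le.mpr hx)
  have hzr : ∀ x, b < x → ψ x = 0 := fun x hx =>
    image_eq_zero_of_notMem_tsupport fun hx' => absurd (hb' hx') (not_le.mpr hx)
  have hc := hψ.1.continuous
  have hd : ∀ x, HasDerivAt (fun x => ∫ t in (0 : ℝ)..x, ψ t) (ψ x) x := fun x =>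
    intervalIntegral.integral_hasDerivAt_right (hc.intervalIntegrable _ _)
      hc.aestronglyMeasurable.stronglyMeasurableAtFilter hc.continuousAt
  have hderiv : deriv (fun x => ∫ t in (0 : ℝ)..x, ψ t) = ψ := funext fun x => (hd x).deriv
  have hsupp : Function.support (fun x => ∫ t in (0 : ℝ)..x, ψ t) ⊆ Icc a b := by
    intro x hx
    by_contra hx'
    apply hx
    rcases not_and_or.mp hx' with h | h
    · have h := not_le.mp h
      refine intervalIntegral.integral_zero_ae (Eventually.of_forall fun t ht => hzl t ?_)
      rcases le_total 0 x with h2 | h2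
      · rw [uIoc_of_le h2] at ht; exact ht.2.trans_lt h
      · rw [uIoc_of_ge h2] at ht; exact ht.2.trans_lt ha0.1
    · have h := not_le.mp h
      have : ∫ t in x..L, ψ t = 0 := by
        refine intervalIntegral.integral_zero_ae (Eventually.of_forall fun t ht => hzr t ?_)
        rcases le_total x L with h2 | h2
        · rw [uIoc_of_le h2] at ht; exact h.trans ht.1
        · rw [uIoc_of_ge h2] at ht; exact hb0.2.trans ht.1
      have h3 := intervalIntegral.integral_add_adjacent_intervals (hc.intervalIntegrable 0 x)
        (hc.intervalIntegrable x L) (μ := volume)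
      rwa [this, add_zero, h0] at h3
  have hts : tsupport (fun x => ∫ t in (0 : ℝ)..x, ψ t) ⊆ Icc a b :=
    closure_minimal hsupp isClosed_Icc
  refine ⟨_, ⟨?_, ?_, hts.trans fun x hx => ⟨ha0.1.trans_le hx.1, hx.2.trans_lt hb0.2⟩⟩, hderiv⟩
  · rw [contDiff_infty_iff_deriv, hderiv]
    exact ⟨fun x => (hd x).differentiableAt, hψ.1⟩
  · exact HasCompactSupport.intro isCompact_Icc fun x hx =>
      Function.notMem_support.mp fun h => hx (hsupp h)

theorem exists_test_integral_one {L : ℝ} (hL : 0 < L) :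
    ∃ χ, IsTest L χ ∧ ∫ x in (0 : ℝ)..L, χ x = 1 := by
  let f : ContDiffBump (L / 2) := ⟨L / 8, L / 4, by positivity, by linarith⟩
  have hts : tsupport (f.normed volume) ⊆ Ioo 0 L := by
    rw [f.tsupport_normed_eq, Real.closedBall_eq_Icc]
    intro x hx
    have h1 := hx.1
    have h2 := hx.2
    simp only [f] at h1 h2
    constructor <;> linarith
  refine ⟨f.normed volume, ⟨f.contDiff_normed, f.hasCompactSupport_normed, hts⟩, ?_⟩
  rw [intervalIntegral.integral_of_le hL.le, setIntegral_eq_integral_of_forall_compl_eq_zero]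
  · exact f.integral_normed
  · intro x hx
    exact image_eq_zero_of_notMem_tsupport fun h => hx ⟨(hts h).1, (hts h).2.le⟩

/-- The representative of a function `u` with weak derivative `v`, reconstructed from `u` and `v` by
linear operations. -/
def rep (L : ℝ) (u v : ℝ → E3) (x : ℝ) : E3 :=
  L⁻¹ • ((∫ t, u t ∂(mu L)) - ∫ t, prim v t ∂(mu L)) + prim v x

theorem IsWeakDeriv.ae_eq_rep {L : ℝ} (hL : 0 < L) {u v : L2 L} (h : IsWeakDeriv L u v) :
    (u : ℝ → E3) =ᵐ[mu L] rep L u v := by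
  have hu := L2_integrable u
  have hP : Integrable (prim v) (mu L) :=
    integrable_of_continuousOn (continuousOn_prim hL.le (L2_integrable v))
  obtain ⟨χ, hχ, hχ1⟩ := exists_test_integral_one hL
  have hint : ∀ ψ, IsTest L ψ → Integrable (fun x => ψ x • (u x - prim v x)) (mu L) := by
    intro ψ hψ
    obtain ⟨C, hC⟩ := hψ.2.1.exists_bound_of_continuous hψ.1.continuous
    exact (hu.sub hP).bdd_smul C hψ.1.continuous.aestronglyMeasurable (Eventually.of_forall hC)
  set c : E3 := ∫ x in Ioo 0 L, χ x • (u x - prim v x) with hc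
  have hconst : (fun x => u x - prim v x) =ᵐ[mu L] fun _ => c := by
    refine ae_eq_of_forall_test (hu.sub hP) (integrable_const c) fun ψ hψ => ?_
    set s : ℝ := ∫ x in (0 : ℝ)..L, ψ x with hs
    have hψχ : IsTest L (fun x => ψ x - s * χ x) := by
      have hsub : tsupport (fun x => ψ x - s * χ x) ⊆ tsupport ψ ∪ tsupport χ := by
        refine closure_minimal (fun x hx => ?_) ((isClosed_tsupport _).union (isClosed_tsupport _))
        by_contra h'
        rw [mem_union, not_or] at h'
        apply hx
        simp [image_eq_zero_of_notMem_tsupport h'.1, image_eq_zero_of_notMem_tsupport h'.2]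
      exact ⟨hψ.1.sub (contDiff_const.mul hχ.1),
        (hψ.2.1.union hχ.2.1).of_isClosed_subset (isClosed_tsupport _) hsub,
        hsub.trans (union_subset hψ.2.2 hχ.2.2)⟩
    obtain ⟨φ, hφ, hφ'⟩ := exists_test_primitive hψχ (by
      rw [intervalIntegral.integral_sub (hψ.1.continuous.intervalIntegrable _ _)
        ((hχ.1.continuous.const_mul s).intervalIntegrable _ _),
        intervalIntegral.integral_const_mul, hχ1, mul_one, sub_self])
    have h1 := h φ hφ
    have h2 := integral_deriv_smul_prim hL v hφ
    have hiP : Integrable (fun x => deriv φ x • prim v x) (mu L) := by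
      have hd : Continuous (deriv φ) := hφ.1.continuous_deriv (by simp)
      exact integrable_of_continuousOn
        (hd.continuousOn.smul (continuousOn_prim hL.le (L2_integrable v)))
    have h3 : ∫ x in Ioo 0 L, deriv φ x • (u x - prim v x) = 0 := by
      simp only [smul_sub]
      rw [integral_sub (hφ.integrable_deriv u) hiP, h1, h2, sub_self]
    rw [hφ'] at h3
    simp only [sub_smul, mul_smul] at h3
    rw [integral_sub (hint ψ hψ) ((hint χ hχ).fun_smul s), integral_smul, sub_eq_zero] at h3
    rw [h3, integral_smul_const, integral_mu hL.le ψ]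
  have hci : (∫ t, u t ∂(mu L)) - ∫ t, prim v t ∂(mu L) = L • c := by
    rw [← integral_sub hu hP, integral_congr_ae hconst, integral_const]
    simp [measureReal_def, hL.le]
  filter_upwards [hconst] with x hx
  rw [rep, hci, smul_smul, inv_mul_cancel₀ hL.ne', one_smul, ← hx, sub_add_cancel]

theorem rep_sub {L : ℝ} {u v : ℝ → E3} (hv : Integrable v (mu L)) {a b : ℝ} (ha : a ∈ Icc 0 L)
    (hb : b ∈ Icc 0 L) : rep L u v b - rep L u v a = ∫ t in a..b, v t := by
  rw [← prim_sub hv ha hb, rep, rep, add_sub_add_left_eq_sub]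

theorem continuousOn_rep {L : ℝ} (hL : 0 ≤ L) (u : ℝ → E3) {v : ℝ → E3}
    (hv : Integrable v (mu L)) : ContinuousOn (rep L u v) (Icc 0 L) :=
  continuousOn_const.add (continuousOn_prim hL hv)

/-- A continuous function that is differentiable off a countable set is weakly differentiable. -/
theorem isWeakDeriv_of_hasDerivAt {L : ℝ} (hL : 0 ≤ L) {u v : L2 L} {U G : ℝ → E3} {s : Set ℝ}
    (hs : s.Countable) (hU : ContinuousOn U (Icc 0 L))
    (hd : ∀ x ∈ Ioo 0 L \ s, HasDerivAt U (G x) x) (hu : (u : ℝ → E3) =ᵐ[mu L] U)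
    (hv : (v : ℝ → E3) =ᵐ[mu L] G) : IsWeakDeriv L u v := by
  intro φ hφ
  have i1 : Integrable (fun x => φ x • G x) (mu L) :=
    (hφ.integrable v).congr (by filter_upwards [hv] with x hx; rw [hx])
  have i2 : Integrable (fun x => deriv φ x • U x) (mu L) :=
    (hφ.integrable_deriv u).congr (by filter_upwards [hu] with x hx; rw [hx])
  have key := integral_eq_of_hasDerivAt_off_countable_of_le (fun x => φ x • U x)
    (fun x => φ x • G x + deriv φ x • U x) hL hs (hφ.1.continuous.continuousOn.smul hU)
    (fun x hx => ((hφ.1.differentiable (by simp)).differentiableAt.hasDerivAt).fun_smul (hd x hx))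
    (intervalIntegrable_of_mu (i1.add i2) hL)
  rw [hφ.zero_left, hφ.zero_right, zero_smul, zero_smul, sub_zero, ← integral_mu hL,
    integral_add i1 i2] at key
  have e1 : ∫ x in Ioo 0 L, φ x • v x = ∫ x, φ x • G x ∂(mu L) :=
    integral_congr_ae (by filter_upwards [hv] with x hx; rw [hx])
  have e2 : ∫ x in Ioo 0 L, deriv φ x • u x = ∫ x, deriv φ x • U x ∂(mu L) :=
    integral_congr_ae (by filter_upwards [hu] with x hx; rw [hx])
  rw [e1, e2]
  exact (neg_eq_of_add_eq_zero_right key).symm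

theorem IsWeakDeriv.unique {L : ℝ} {u v w : L2 L} (h : IsWeakDeriv L u v) (k : IsWeakDeriv L u w) :
    (v : ℝ → E3) =ᵐ[mu L] w :=
  ae_eq_of_forall_test (L2_integrable v) (L2_integrable w) fun φ hφ =>
    neg_injective ((h φ hφ).symm.trans (k φ hφ))

theorem memLp_of_continuousOn {L : ℝ} {f : ℝ → E3} (hf : ContinuousOn f (Icc 0 L)) :
    MemLp f 2 (mu L) := by
  obtain ⟨C, hC⟩ := isCompact_Icc.exists_bound_of_continuousOn hf
  refine MemLp.of_bound ((hf.mono Ioo_subset_Icc_self).aestronglyMeasurable measurableSet_Ioo) C ?_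
  filter_upwards [ae_mem_mu L] with x hx
  exact hC x (Ioo_subset_Icc_self hx)

theorem IsWeakDeriv.ae_eq_of_hasDerivAt {L : ℝ} (hL : 0 ≤ L) {u v : L2 L} (h : IsWeakDeriv L u v)
    {U G : ℝ → E3} (hU : ContinuousOn U (Icc 0 L)) (hG : ContinuousOn G (Icc 0 L))
    (hd : ∀ x ∈ Ioo 0 L, HasDerivAt U (G x) x) (hu : U =ᵐ[mu L] u) : (v : ℝ → E3) =ᵐ[mu L] G := by
  have hG2 := memLp_of_continuousOn hG
  have k : IsWeakDeriv L u (hG2.toLp G) :=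
    isWeakDeriv_of_hasDerivAt hL countable_empty hU (fun x hx => hd x hx.1) hu.symm hG2.coeFn_toLp
  exact (h.unique k).trans hG2.coeFn_toLp

theorem eqOn_Icc_of_ae_eq {F : Type*} [TopologicalSpace F] [T2Space F] {L : ℝ} (hL : 0 < L)
    {f g : ℝ → F} (hf : ContinuousOn f (Icc 0 L)) (hg : ContinuousOn g (Icc 0 L))
    (h : f =ᵐ[mu L] g) : EqOn f g (Icc 0 L) := by
  refine Measure.eqOn_Icc_of_ae_eq volume hL.ne ?_ hf hg
  rwa [← Measure.restrict_congr_set Ioo_ae_eq_Icc]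

/-! ### The two components of `V` and their representatives -/

theorem memLp_wd {L : ℝ} {k : ℕ} (u : Sobolev L k) (i : Fin (k + 1)) : MemLp (wd u i) 2 (mu L) :=
  Lp.memLp _

theorem integrable_wd {L : ℝ} {k : ℕ} (u : Sobolev L k) (i : Fin (k + 1)) :
    Integrable (wd u i) (mu L) := L2_integrable _

/-- The continuous representative of `y'`. -/
def repT {L : ℝ} (v : V L) : ℝ → E3 := rep L (wd v.1 1) (wd v.1 2)

/-- The continuous representative of `b`. -/
def repB {L : ℝ} (v : V L) : ℝ → E3 := rep L (wd v.2 0) (wd v.2 1)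

theorem ae_eq_repT {L : ℝ} (hL : 0 < L) (v : V L) : wd v.1 1 =ᵐ[mu L] repT v :=
  IsWeakDeriv.ae_eq_rep hL (v.1.2 1)

theorem ae_eq_repB {L : ℝ} (hL : 0 < L) (v : V L) : wd v.2 0 =ᵐ[mu L] repB v :=
  IsWeakDeriv.ae_eq_rep hL (v.2.2 0)

theorem continuousOn_repT {L : ℝ} (hL : 0 < L) (v : V L) : ContinuousOn (repT v) (Icc 0 L) :=
  continuousOn_rep hL.le _ (integrable_wd _ _)

theorem continuousOn_repB {L : ℝ} (hL : 0 < L) (v : V L) : ContinuousOn (repB v) (Icc 0 L) :=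
  continuousOn_rep hL.le _ (integrable_wd _ _)

theorem hasDerivAt_der {L : ℝ} {Y : ℝ → E3} (hY : ContDiffOn ℝ 1 Y (Icc 0 L)) {x : ℝ}
    (hx : x ∈ Ioo 0 L) : HasDerivAt Y (der L Y x) x :=
  ((hY.differentiableOn (by simp) x (Ioo_subset_Icc_self hx)).hasDerivWithinAt).hasDerivAt
    (Icc_mem_nhds hx.1 hx.2)

theorem continuousOn_der {L : ℝ} (hL : 0 < L) {Y : ℝ → E3} (hY : ContDiffOn ℝ 1 Y (Icc 0 L)) :
    ContinuousOn (der L Y) (Icc 0 L) :=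
  hY.continuousOn_derivWithin (uniqueDiffOn_Icc hL) (by simp)

theorem IsRep.ae_eq_der {L : ℝ} (hL : 0 < L) {v : V L} {Y B : ℝ → E3} (h : IsRep v Y B) :
    wd v.1 1 =ᵐ[mu L] der L Y :=
  IsWeakDeriv.ae_eq_of_hasDerivAt hL.le (v.1.2 0) h.contDiffOn.continuousOn
    (continuousOn_der hL h.contDiffOn) (fun _ hx => hasDerivAt_der h.contDiffOn hx) h.ae_eq_y

theorem IsRep.eqOn_repT {L : ℝ} (hL : 0 < L) {v : V L} {Y B : ℝ → E3} (h : IsRep v Y B) :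
    EqOn (der L Y) (repT v) (Icc 0 L) :=
  eqOn_Icc_of_ae_eq hL (continuousOn_der hL h.contDiffOn) (continuousOn_repT hL v)
    ((h.ae_eq_der hL).symm.trans (ae_eq_repT hL v))

theorem IsRep.eqOn_repB {L : ℝ} (hL : 0 < L) {v : V L} {Y B : ℝ → E3} (h : IsRep v Y B) :
    EqOn B (repB v) (Icc 0 L) :=
  eqOn_Icc_of_ae_eq hL h.continuousOn (continuousOn_repB hL v)
    (h.ae_eq_b.trans (ae_eq_repB hL v))

/-! ### Estimates for representatives -/

theorem L2_norm_sq {L : ℝ} (f : L2 L) : ‖f‖ ^ 2 = ∫ x, ‖f x‖ ^ 2 ∂(mu L) := by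
  rw [← real_inner_self_eq_norm_sq, L2.inner_def]
  simp only [real_inner_self_eq_norm_sq]

theorem L2_integrable_norm_sq {L : ℝ} (f : L2 L) : Integrable (fun x => ‖f x‖ ^ 2) (mu L) :=
  (memLp_two_iff_integrable_sq_norm (Lp.memLp f).1).mp (Lp.memLp f)

theorem integral_norm_le {L : ℝ} (hL : 0 ≤ L) (f : L2 L) :
    ∫ x, ‖f x‖ ∂(mu L) ≤ (L + ‖f‖ ^ 2) / 2 := by
  have h : ∫ x, ‖f x‖ ∂(mu L) ≤ ∫ x, (1 + ‖f x‖ ^ 2) / 2 ∂(mu L) := by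
    refine integral_mono (L2_integrable f).norm
      (((integrable_const 1).add (L2_integrable_norm_sq f)).div_const 2) fun x => ?_
    have := sq_nonneg (‖f x‖ - 1)
    simp only
    linarith
  rw [integral_div, integral_add (integrable_const _) (L2_integrable_norm_sq f), ← L2_norm_sq] at h
  simpa [measureReal_def, hL] using h

theorem norm_rep_le {L : ℝ} (hL : 0 < L) (u v : L2 L) {x : ℝ} (hx : x ∈ Icc 0 L) :
    ‖rep L u v x‖ ≤ L⁻¹ * ((L + ‖u‖ ^ 2) / 2 + L * ((L + ‖v‖ ^ 2) / 2)) + (L + ‖v‖ ^ 2) / 2 := by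
  have hp : ∀ x ∈ Icc 0 L, ‖prim v x‖ ≤ (L + ‖v‖ ^ 2) / 2 := fun x hx =>
    (norm_prim_le (L2_integrable v) hx).trans (integral_norm_le hL.le v)
  have h1 : ‖∫ t, u t ∂(mu L)‖ ≤ (L + ‖u‖ ^ 2) / 2 :=
    (norm_integral_le_integral_norm _).trans (integral_norm_le hL.le u)
  have h2 : ‖∫ t, prim v t ∂(mu L)‖ ≤ L * ((L + ‖v‖ ^ 2) / 2) := by
    refine (norm_integral_le_of_norm_le_const (C := (L + ‖v‖ ^ 2) / 2) ?_).trans ?_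
    · filter_upwards [ae_mem_mu L] with y hy
      exact hp y (Ioo_subset_Icc_self hy)
    · simp [measureReal_def, hL.le, mul_comm]
  refine (norm_add_le _ _).trans (add_le_add ?_ (hp x hx))
  rw [norm_smul, Real.norm_of_nonneg (inv_nonneg.mpr hL.le)]
  exact mul_le_mul_of_nonneg_left ((norm_sub_le _ _).trans (add_le_add h1 h2))
    (inv_nonneg.mpr hL.le)

theorem norm_rep_sub_le {L : ℝ} (u : ℝ → E3) (v : L2 L) {a b : ℝ} (ha : a ∈ Icc 0 L)
    (hb : b ∈ Icc 0 L) (hab : a ≤ b) :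
    ‖rep L u v b - rep L u v a‖ ≤ √(b - a) * ((1 + ‖v‖ ^ 2) / 2) := by
  rcases hab.eq_or_lt with rfl | hab'
  · simp
  have hL : 0 ≤ L := ha.1.trans ha.2
  have hv := L2_integrable v
  have hv2 := L2_integrable_norm_sq v
  have hr : 0 < √(b - a) := Real.sqrt_pos.mpr (sub_pos.mpr hab')
  have hr2 : √(b - a) ^ 2 = b - a := Real.sq_sqrt (sub_pos.mpr hab').le
  rw [rep_sub hv ha hb]
  set r := √(b - a)
  have i2 : IntervalIntegrable (fun x => ‖v x‖ ^ 2) volume a b := intervalIntegrable_sub hv2 ha hb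
  have h1 : ∫ x in a..b, ‖v x‖ ^ 2 ≤ ‖v‖ ^ 2 := by
    rw [L2_norm_sq, integral_mu hL]
    exact intervalIntegral.integral_mono_interval ha.1 hab hb.2
      (Eventually.of_forall fun _ => sq_nonneg _) (intervalIntegrable_of_mu hv2 hL)
  have h2 : ∫ x in a..b, ‖v x‖ ≤ ∫ x in a..b, (r⁻¹ / 2 + r / 2 * ‖v x‖ ^ 2) := by
    refine intervalIntegral.integral_mono_on hab (intervalIntegrable_sub hv ha hb).norm
      (intervalIntegrable_const.add (i2.const_mul _)) fun x _ => ?_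
    have : 0 ≤ r⁻¹ / 2 * (r * ‖v x‖ - 1) ^ 2 := by positivity
    have e : r⁻¹ / 2 * (r * ‖v x‖ - 1) ^ 2 = r⁻¹ / 2 + r / 2 * ‖v x‖ ^ 2 - ‖v x‖ := by
      field_simp; ring
    linarith
  rw [intervalIntegral.integral_add intervalIntegrable_const (i2.const_mul _),
    intervalIntegral.integral_const, intervalIntegral.integral_const_mul, smul_eq_mul, ← hr2] at h2
  refine (intervalIntegral.norm_integral_le_integral_norm hab).trans (h2.trans ?_)
  have e : r ^ 2 * (r⁻¹ / 2) = r / 2 := by field_simp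
  rw [e]
  have := mul_le_mul_of_nonneg_left h1 (half_pos hr).le
  linarith

/-! ### Weak convergence -/

theorem tendsto_apply_of_weak {X : Type*} [NormedAddCommGroup X] [NormedSpace ℝ X] {u : ℕ → X}
    {u₀ : X} (h : Tendsto (fun n => toWeakSpace ℝ X (u n)) atTop (𝓝 (toWeakSpace ℝ X u₀)))
    (l : X →L[ℝ] ℝ) : Tendsto (fun n => l (u n)) atTop (𝓝 (l u₀)) :=
  ((WeakBilin.eval_continuous (topDualPairing ℝ X).flip l).tendsto _).comp h

/-- Weak convergence in `L²`. -/
def WeakTendsto {L : ℝ} (f : ℕ → L2 L) (f₀ : L2 L) : Prop :=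
  ∀ g : L2 L, Tendsto (fun n => inner ℝ g (f n)) atTop (𝓝 (inner ℝ g f₀))

theorem WeakTendsto.bounded {L : ℝ} {f : ℕ → L2 L} {f₀ : L2 L} (h : WeakTendsto f f₀) :
    ∃ C, ∀ n, ‖f n‖ ≤ C := by
  obtain ⟨C, hC⟩ := banach_steinhaus (g := fun n => innerSL ℝ (f n)) fun g => by
    obtain ⟨C, hC⟩ := ((h g).norm.bddAbove_range)
    exact ⟨C, fun n => by
      have := hC (mem_range_self n)
      simpa [real_inner_comm] using this⟩
  exact ⟨C, fun n => by simpa using hC n⟩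

theorem tendsto_of_coord {f : ℕ → E3} {f₀ : E3}
    (h : ∀ i, Tendsto (fun n => f n i) atTop (𝓝 (f₀ i))) : Tendsto f atTop (𝓝 f₀) := by
  have := (PiLp.continuous_toLp 2 (fun _ : Fin 3 => ℝ)).tendsto f₀.ofLp
  exact this.comp (tendsto_pi_nhds.mpr h)

theorem WeakTendsto.setIntegral {L : ℝ} {f : ℕ → L2 L} {f₀ : L2 L} (h : WeakTendsto f f₀)
    {s : Set ℝ} (hs : MeasurableSet s) :
    Tendsto (fun n => ∫ x in s, f n x ∂(mu L)) atTop (𝓝 (∫ x in s, f₀ x ∂(mu L))) := by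
  refine tendsto_of_coord fun i => ?_
  have := h (indicatorConstLp 2 hs (measure_ne_top _ _) (EuclideanSpace.single i 1))
  simpa [L2.inner_indicatorConstLp_eq_inner_setIntegral, EuclideanSpace.inner_single_left]
    using this

theorem prim_eq_setIntegral {L : ℝ} (v : ℝ → E3) {x : ℝ} (hx : x ∈ Icc 0 L) :
    prim v x = ∫ t in Ioo 0 x, v t ∂(mu L) := by
  rw [prim, intervalIntegral.integral_of_le hx.1, integral_Ioc_eq_integral_Ioo, mu,
    Measure.restrict_restrict measurableSet_Ioo,
    inter_eq_left.mpr (Ioo_subset_Ioo_right hx.2)]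

theorem WeakTendsto.prim {L : ℝ} {v : ℕ → L2 L} {v₀ : L2 L} (h : WeakTendsto v v₀) {x : ℝ}
    (hx : x ∈ Icc 0 L) : Tendsto (fun n => prim (v n) x) atTop (𝓝 (prim v₀ x)) := by
  simp only [prim_eq_setIntegral _ hx]
  exact h.setIntegral measurableSet_Ioo

/-- Weak convergence in `H¹` implies pointwise convergence. -/
theorem WeakTendsto.rep {L : ℝ} (hL : 0 < L) {u v : ℕ → L2 L} {u₀ v₀ : L2 L}
    (hu : WeakTendsto u u₀) (hv : WeakTendsto v v₀) {x : ℝ} (hx : x ∈ Icc 0 L) :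
    Tendsto (fun n => rep L (u n) (v n) x) atTop (𝓝 (rep L u₀ v₀ x)) := by
  obtain ⟨C, hC⟩ := hv.bounded
  have h1 : Tendsto (fun n => ∫ t, u n t ∂(mu L)) atTop (𝓝 (∫ t, u₀ t ∂(mu L))) := by
    simpa using hu.setIntegral MeasurableSet.univ
  have h2 : Tendsto (fun n => ∫ t, Ribbon.prim (v n) t ∂(mu L)) atTop
      (𝓝 (∫ t, Ribbon.prim v₀ t ∂(mu L))) := by
    refine tendsto_integral_of_dominated_convergence (fun _ => (L + C ^ 2) / 2)
      (fun n => (integrable_of_continuousOn (continuousOn_prim hL.le (L2_integrable (v n)))).1)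
      (integrable_const _) (fun n => ?_) ?_
    · filter_upwards [ae_mem_mu L] with t ht
      refine (norm_prim_le (L2_integrable (v n)) (Ioo_subset_Icc_self ht)).trans
        ((integral_norm_le hL.le _).trans ?_)
      gcongr
      exact hC n
    · filter_upwards [ae_mem_mu L] with t ht
      exact hv.prim (Ioo_subset_Icc_self ht)
  exact ((h1.sub h2).const_smul _).add (hv.prim hx)

theorem exists_norm_rep_le {L : ℝ} (hL : 0 < L) {u v : ℕ → L2 L} {u₀ v₀ : L2 L}
    (hu : WeakTendsto u u₀) (hv : WeakTendsto v v₀) :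
    ∃ M, ∀ n, ∀ x ∈ Icc 0 L, ‖rep L (u n) (v n) x‖ ≤ M := by
  obtain ⟨C, hC⟩ := hu.bounded
  obtain ⟨D, hD⟩ := hv.bounded
  refine ⟨L⁻¹ * ((L + C ^ 2) / 2 + L * ((L + D ^ 2) / 2)) + (L + D ^ 2) / 2, fun n x hx =>
    (norm_rep_le hL (u n) (v n) hx).trans ?_⟩
  have := hC n
  have := hD n
  gcongr

/-- The `i`-th weak derivative as a continuous linear map. -/
def wdL (L : ℝ) (k : ℕ) (i : Fin (k + 1)) : Sobolev L k →L[ℝ] L2 L :=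
  (PiLp.proj 2 (𝕜 := ℝ) (fun _ : Fin (k + 1) => L2 L) i).comp (Sobolev L k).subtypeL

theorem wdL_coe {L : ℝ} {k : ℕ} (u : Sobolev L k) (i : Fin (k + 1)) : ⇑(wdL L k i u) = wd u i := rfl

theorem weakTendsto_fst {L : ℝ} {u : ℕ → V L} {u₀ : V L}
    (h : Tendsto (fun n => toWeakSpace ℝ (V L) (u n)) atTop (𝓝 (toWeakSpace ℝ (V L) u₀)))
    (i : Fin 3) : WeakTendsto (fun n => wdL L 2 i (u n).1) (wdL L 2 i u₀.1) := fun g =>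
  tendsto_apply_of_weak h ((innerSL ℝ g).comp ((wdL L 2 i).comp (ContinuousLinearMap.fst ℝ _ _)))

theorem weakTendsto_snd {L : ℝ} {u : ℕ → V L} {u₀ : V L}
    (h : Tendsto (fun n => toWeakSpace ℝ (V L) (u n)) atTop (𝓝 (toWeakSpace ℝ (V L) u₀)))
    (i : Fin 2) : WeakTendsto (fun n => wdL L 1 i (u n).2) (wdL L 1 i u₀.2) := fun g =>
  tendsto_apply_of_weak h ((innerSL ℝ g).comp ((wdL L 1 i).comp (ContinuousLinearMap.snd ℝ _ _)))

/-! ### Partitionings -/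

namespace Mesh

variable {L : ℝ} (T : Mesh L)

theorem node_mem (i : Fin (T.N + 1)) : T.node i ∈ Icc 0 L := by
  refine ⟨?_, ?_⟩
  · rw [← T.node_zero]; exact T.strictMono.monotone (Fin.zero_le _)
  · conv_rhs => rw [← T.node_last]
    exact T.strictMono.monotone (Fin.le_last _)

theorem node_lt (j : Fin T.N) : T.node j.castSucc < T.node j.succ :=
  T.strictMono j.castSucc_lt_succ

theorem elemSize_le (j : Fin T.N) : T.elemSize j ≤ T.size :=
  le_ciSup (f := fun j => T.elemSize j) (Set.finite_range _).bddAbove j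

theorem exists_elem (hL : 0 < L) {x : ℝ} (hx : x ∈ Icc 0 L) :
    ∃ j : Fin T.N, x ∈ Icc (T.node j.castSucc) (T.node j.succ) := by
  have key : ∀ i : Fin (T.N + 1), 0 < i → x ≤ T.node i →
      ∃ j : Fin T.N, x ∈ Icc (T.node j.castSucc) (T.node j.succ) := by
    intro i
    induction i using Fin.induction with
    | zero => intro h; exact absurd h (lt_irrefl _)
    | succ i ih =>
      intro _ h
      by_cases hi : T.node i.castSucc ≤ x
      · exact ⟨i, hi, h⟩
      · refine ih ?_ (not_le.mp hi).le
        by_contra h0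
        have : i.castSucc = 0 := le_antisymm (not_lt.mp h0) (Fin.zero_le _)
        rw [this, T.node_zero] at hi
        exact hi hx.1
  refine key (Fin.last _) ?_ (by rw [T.node_last]; exact hx.2)
  by_contra h0
  have h1 : Fin.last T.N = 0 := le_antisymm (not_lt.mp h0) (Fin.zero_le _)
  have h2 := T.node_last
  rw [h1, T.node_zero] at h2
  exact hL.ne h2

theorem exists_node_near (hL : 0 < L) {x : ℝ} (hx : x ∈ Icc 0 L) :
    ∃ i, T.node i ≤ x ∧ x - T.node i ≤ T.size := by
  obtain ⟨j, h1, h2⟩ := T.exists_elem hL hx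
  refine ⟨j.castSucc, h1, le_trans ?_ (T.elemSize_le j)⟩
  unfold elemSize
  linarith

end Mesh

/-- A weak limit of functions that have norm one at the nodes of refining partitionings has norm one
everywhere. -/
theorem norm_rep_eq_one {L : ℝ} (hL : 0 < L) {T : ℕ → Mesh L}
    (hT : Tendsto (fun n => (T n).size) atTop (𝓝 0)) {u v : ℕ → L2 L} {u₀ v₀ : L2 L}
    (hu : WeakTendsto u u₀) (hv : WeakTendsto v v₀)
    (h : ∀ n j, ‖rep L (u n) (v n) ((T n).node j)‖ = 1) {x : ℝ} (hx : x ∈ Icc 0 L) :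
    ‖rep L u₀ v₀ x‖ = 1 := by
  obtain ⟨C, hC⟩ := hv.bounded
  refine tendsto_nhds_unique (hu.rep hL hv hx).norm ?_
  rw [tendsto_iff_dist_tendsto_zero]
  have hs : Tendsto (fun n => √(T n).size * ((1 + C ^ 2) / 2)) atTop (𝓝 0) := by
    have := ((Real.continuous_sqrt.tendsto 0).comp hT).mul_const ((1 + C ^ 2) / 2)
    simpa using this
  refine squeeze_zero (fun _ => dist_nonneg) (fun n => ?_) hs
  obtain ⟨i, hi, hi'⟩ := (T n).exists_node_near hL hx
  have h1 := abs_norm_sub_norm_le (Ribbon.rep L (u n) (v n) x)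
    (Ribbon.rep L (u n) (v n) ((T n).node i))
  rw [h n i] at h1
  rw [Real.dist_eq]
  refine h1.trans ((norm_rep_sub_le (u n) (v n) ((T n).node_mem i) hx hi).trans ?_)
  have := hC n
  gcongr

/-! ### Lower bounds for the energies -/

theorem aestronglyMeasurable_wd {L : ℝ} {k : ℕ} (u : Sobolev L k) (i : Fin (k + 1)) :
    AEStronglyMeasurable (wd u i) (mu L) := (memLp_wd u i).1

theorem integrable_wd_norm_sq {L : ℝ} {k : ℕ} (u : Sobolev L k) (i : Fin (k + 1)) :
    Integrable (fun x => ‖wd u i x‖ ^ 2) (mu L) := L2_integrable_norm_sq _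

theorem aemeasurable_norms {L : ℝ} (v : V L) :
    AEMeasurable (fun x => (‖wd v.1 2 x‖, ‖wd v.2 1 x‖)) (mu L) :=
  (aestronglyMeasurable_wd v.1 2).norm.aemeasurable.prodMk
    (aestronglyMeasurable_wd v.2 1).norm.aemeasurable

theorem integrable_Qbar {L : ℝ} (v : V L) :
    Integrable (fun x => Qbar ‖wd v.1 2 x‖ ‖wd v.2 1 x‖) (mu L) := by
  refine ((integrable_wd_norm_sq v.1 2).add ((integrable_wd_norm_sq v.2 1).const_mul 4)).mono'
    (measurable_Qbar.comp_aemeasurable (aemeasurable_norms v)).aestronglyMeasurable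
    (Eventually.of_forall fun x => ?_)
  rw [Real.norm_of_nonneg (Qbar_nonneg _ _)]
  exact Qbar_le (norm_nonneg _) (norm_nonneg _)

theorem integrable_Qreg {L : ℝ} {r : ℝ → ℝ} {η : ℝ} (hr : Measurable r) (h0 : ∀ x, 0 ≤ r x)
    (h : ∀ x, |r x - abs x| ≤ η) (v : V L) :
    Integrable (fun x => Qreg r ‖wd v.1 2 x‖ ‖wd v.2 1 x‖) (mu L) := by
  have h1 : Integrable (fun x => Qreg r ‖wd v.1 2 x‖ ‖wd v.2 1 x‖
      - Qbar ‖wd v.1 2 x‖ ‖wd v.2 1 x‖) (mu L) := by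
    refine Integrable.of_bound ?_ (5 / 2 * η)
      (Eventually.of_forall fun x => abs_Qreg_sub_Qbar_le h0 h _ _)
    exact (((measurable_Qreg hr).sub measurable_Qbar).comp_aemeasurable
      (aemeasurable_norms v)).aestronglyMeasurable
  exact (h1.add (integrable_Qbar v)).congr (Eventually.of_forall fun x => by simp)

theorem abs_integral_Qreg_sub_energy_le {L : ℝ} (hL : 0 ≤ L) {r : ℝ → ℝ} {η : ℝ} (hr : Measurable r)
    (h0 : ∀ x, 0 ≤ r x) (h : ∀ x, |r x - abs x| ≤ η) (v : V L) :
    |(∫ x in Ioo 0 L, Qreg r ‖wd v.1 2 x‖ ‖wd v.2 1 x‖) - energy v| ≤ 5 / 2 * η * L := by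
  rw [energy, ← integral_sub (integrable_Qreg hr h0 h v) (integrable_Qbar v)]
  have hb : ∀ x, ‖Qreg r ‖wd v.1 2 x‖ ‖wd v.2 1 x‖ - Qbar ‖wd v.1 2 x‖ ‖wd v.2 1 x‖‖
      ≤ 5 / 2 * η := fun x => abs_Qreg_sub_Qbar_le h0 h _ _
  refine (norm_integral_le_of_norm_le_const (Eventually.of_forall hb)).trans ?_
  simp [measureReal_def, hL]

theorem memLp_smul_of_bound {L : ℝ} {k : ℝ → ℝ} {f : ℝ → E3} {K : ℝ} (hk : AEMeasurable k (mu L))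
    (hK : ∀ x, ‖k x‖ ≤ K) (hf : MemLp f 2 (mu L)) : MemLp (fun x => k x • f x) 2 (mu L) := by
  refine hf.of_le_mul (c := K) (hk.aestronglyMeasurable.smul hf.1)
    (Eventually.of_forall fun x => ?_)
  rw [norm_smul]
  exact mul_le_mul_of_nonneg_right (hK x) (norm_nonneg _)

theorem norm_toLp_smul_le {L : ℝ} {k : ℝ → ℝ} {K : ℝ} (hK : ∀ x, ‖k x‖ ≤ K) (f : L2 L)
    (h : MemLp (fun x => k x • f x) 2 (mu L)) : ‖h.toLp _‖ ≤ K * ‖f‖ := by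
  refine Lp.norm_le_mul_norm_of_ae_le_mul ?_
  filter_upwards [h.coeFn_toLp] with x hx
  rw [hx, norm_smul]
  exact mul_le_mul_of_nonneg_right (hK x) (norm_nonneg _)

theorem norm_wdL_le {L : ℝ} {k : ℕ} (u : Sobolev L k) (i : Fin (k + 1)) : ‖wdL L k i u‖ ≤ ‖u‖ :=
  PiLp.norm_apply_le (u : PiLp 2 (fun _ : Fin (k + 1) => L2 L)) i

/-- The energy lies above an affine continuous function that touches it at a given point. -/
theorem energy_tangent {L : ℝ} (v : V L) :
    ∃ l : V L →L[ℝ] ℝ, (∀ w, energy v + l (w - v) ≤ energy w) ∧ ∀ w, |l w| ≤ 10 * ‖v‖ * ‖w‖ := by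
  let s : ℝ → ℝ := fun x => slope ‖wd v.1 2 x‖ ‖wd v.2 1 x‖
  have hsm : AEMeasurable s (mu L) := measurable_slope.comp_aemeasurable (aemeasurable_norms v)
  have hs0 : ∀ x, 0 ≤ s x := fun x => slope_nonneg (norm_nonneg _) (norm_nonneg _)
  have hs1 : ∀ x, s x ≤ 1 := fun x => slope_le_one (norm_nonneg _) (norm_nonneg _)
  have hA : ∀ x, ‖2 * (1 - s x ^ 4)‖ ≤ 2 := fun x => by
    have h1 : s x ^ 4 ≤ 1 := pow_le_one₀ (hs0 x) (hs1 x)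
    have h2 : 0 ≤ s x ^ 4 := pow_nonneg (hs0 x) 4
    rw [Real.norm_of_nonneg (by linarith)]
    linarith
  have hB : ∀ x, ‖4 * (1 + s x ^ 2)‖ ≤ 8 := fun x => by
    have h1 : s x ^ 2 ≤ 1 := pow_le_one₀ (hs0 x) (hs1 x)
    have h2 : 0 ≤ s x ^ 2 := sq_nonneg _
    rw [Real.norm_of_nonneg (by linarith)]
    linarith
  have ha : MemLp (fun x => (2 * (1 - s x ^ 4)) • wd v.1 2 x) 2 (mu L) :=
    memLp_smul_of_bound (((hsm.pow_const 4).const_sub 1).const_mul 2) hA (memLp_wd v.1 2)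
  have hb : MemLp (fun x => (4 * (1 + s x ^ 2)) • wd v.2 1 x) 2 (mu L) :=
    memLp_smul_of_bound (((hsm.pow_const 2).const_add 1).const_mul 4) hB (memLp_wd v.2 1)
  set ga := ha.toLp _ with hga
  set gb := hb.toLp _ with hgb
  refine ⟨(innerSL ℝ ga).comp ((wdL L 2 2).comp (ContinuousLinearMap.fst ℝ _ _))
    + (innerSL ℝ gb).comp ((wdL L 1 1).comp (ContinuousLinearMap.snd ℝ _ _)), fun w => ?_,
    fun w => ?_⟩
  swap
  · simp only [_root_.add_apply, ContinuousLinearMap.comp_apply,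
      ContinuousLinearMap.coe_fst', ContinuousLinearMap.coe_snd', innerSL_apply_apply]
    have h1 : ‖ga‖ ≤ 2 * ‖v‖ := (norm_toLp_smul_le hA (wdL L 2 2 v.1) ha).trans (by
      gcongr; exact (norm_wdL_le _ _).trans (norm_fst_le v))
    have h2 : ‖gb‖ ≤ 8 * ‖v‖ := (norm_toLp_smul_le hB (wdL L 1 1 v.2) hb).trans (by
      gcongr; exact (norm_wdL_le _ _).trans (norm_snd_le v))
    have h3 := (abs_real_inner_le_norm ga (wdL L 2 2 w.1)).trans (mul_le_mul h1
      ((norm_wdL_le _ _).trans (norm_fst_le w)) (norm_nonneg _) (by positivity))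
    have h4 := (abs_real_inner_le_norm gb (wdL L 1 1 w.2)).trans (mul_le_mul h2
      ((norm_wdL_le _ _).trans (norm_snd_le w)) (norm_nonneg _) (by positivity))
    refine (abs_add_le _ _).trans ((add_le_add h3 h4).trans (le_of_eq (by ring)))
  have e : ∀ f g : L2 L, Integrable (fun x => inner ℝ (f x) (g x)) (mu L) := fun f g =>
    L2.integrable_inner f g
  simp only [_root_.add_apply, ContinuousLinearMap.comp_apply,
    ContinuousLinearMap.coe_fst', ContinuousLinearMap.coe_snd', innerSL_apply_apply,
    L2.inner_def, energy]
  rw [← integral_add (e _ _) (e _ _), ← integral_add (integrable_Qbar v) ((e _ _).fun_add (e _ _))]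
  refine integral_mono_ae ((integrable_Qbar v).fun_add ((e _ _).fun_add (e _ _))) (integrable_Qbar w) ?_
  have k1 : wdL L 2 2 (w - v).1 = wdL L 2 2 w.1 - wdL L 2 2 v.1 := by
    rw [Prod.fst_sub, map_sub]
  have k2 : wdL L 1 1 (w - v).2 = wdL L 1 1 w.2 - wdL L 1 1 v.2 := by
    rw [Prod.snd_sub, map_sub]
  rw [k1, k2]
  filter_upwards [ha.coeFn_toLp, hb.coeFn_toLp, Lp.coeFn_sub (wdL L 2 2 w.1) (wdL L 2 2 v.1),
    Lp.coeFn_sub (wdL L 1 1 w.2) (wdL L 1 1 v.2)] with x h1 h2 h3 h4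
  rw [h1, h2, h3, h4]
  exact Qbar_tangent _ _ _ _

theorem energy_le_add {L : ℝ} (v w : V L) : energy v ≤ energy w + 10 * ‖v‖ * ‖v - w‖ := by
  obtain ⟨l, h1, h2⟩ := energy_tangent v
  have h3 := h1 w
  have h4 := (abs_le.mp (h2 (w - v))).1
  rw [norm_sub_rev] at h4
  linarith

theorem penalty_nonneg {L : ℝ} {f : ℝ → ℝ} {ε : ℝ} (hε : 0 < ε) :
    0 ≤ 1 / (2 * ε) * ∫ x in Ioo 0 L, f x ^ 2 :=
  mul_nonneg (by positivity) (integral_nonneg fun _ => sq_nonneg _)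

theorem energy_le_penalizedEnergy {L : ℝ} (hL : 0 ≤ L) {r : ℝ → ℝ} {η ε₁ ε₂ : ℝ}
    (hr : Measurable r) (h0 : ∀ x, 0 ≤ r x) (h : ∀ x, |r x - abs x| ≤ η) (hε₁ : 0 < ε₁)
    (hε₂ : 0 < ε₂) (v : V L) : energy v - 5 / 2 * η * L ≤ penalizedEnergy r ε₁ ε₂ v := by
  have h1 := (abs_le.mp (abs_integral_Qreg_sub_energy_le hL hr h0 h v)).1
  have h2 := penalty_nonneg (L := L) (f := fun x => inner ℝ (wd v.1 1 x) (wd v.2 0 x)) hε₁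
  have h3 := penalty_nonneg (L := L) (f := fun x => inner ℝ (wd v.1 1 x) (wd v.2 1 x)) hε₂
  unfold penalizedEnergy
  linarith

theorem Qreg_nonneg {r : ℝ → ℝ} (h0 : ∀ x, 0 ≤ r x) (α β : ℝ) : 0 ≤ Qreg r α β := by
  have := h0 (α ^ 2 - β ^ 2)
  unfold Qreg
  positivity

theorem penalties_le {L : ℝ} {r : ℝ → ℝ} {ε₁ ε₂ C : ℝ} (h0 : ∀ x, 0 ≤ r x) (hε₁ : 0 < ε₁)
    (hε₂ : 0 < ε₂) {v : V L} (h : penalizedEnergy r ε₁ ε₂ v ≤ C) :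
    (∫ x in Ioo 0 L, (inner ℝ (wd v.1 1 x) (wd v.2 0 x)) ^ 2 ≤ 2 * ε₁ * C) ∧
      ∫ x in Ioo 0 L, (inner ℝ (wd v.1 1 x) (wd v.2 1 x)) ^ 2 ≤ 2 * ε₂ * C := by
  have h1 : 0 ≤ ∫ x in Ioo 0 L, Qreg r ‖wd v.1 2 x‖ ‖wd v.2 1 x‖ :=
    integral_nonneg fun _ => Qreg_nonneg h0 _ _
  have h2 := penalty_nonneg (L := L) (f := fun x => inner ℝ (wd v.1 1 x) (wd v.2 0 x)) hε₁
  have h3 := penalty_nonneg (L := L) (f := fun x => inner ℝ (wd v.1 1 x) (wd v.2 1 x)) hε₂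
  unfold penalizedEnergy at h
  constructor
  · have h4 : 1 / (2 * ε₁) * (∫ x in Ioo 0 L, (inner ℝ (wd v.1 1 x) (wd v.2 0 x)) ^ 2) ≤ C := by
      linarith
    rwa [one_div, inv_mul_le_iff₀ (by positivity)] at h4
  · have h4 : 1 / (2 * ε₂) * (∫ x in Ioo 0 L, (inner ℝ (wd v.1 1 x) (wd v.2 1 x)) ^ 2) ≤ C := by
      linarith
    rwa [one_div, inv_mul_le_iff₀ (by positivity)] at h4

/-! ### Passage to the limit in the constraints -/

theorem inner_eq_zero_of_penalty {L : ℝ} (hL : 0 < L) {u : ℕ → V L} {u₀ : V L}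
    (h : Tendsto (fun n => toWeakSpace ℝ (V L) (u n)) atTop (𝓝 (toWeakSpace ℝ (V L) u₀)))
    (hp : Tendsto (fun n => ∫ x in Ioo 0 L, (inner ℝ (wd (u n).1 1 x) (wd (u n).2 0 x)) ^ 2) atTop
      (𝓝 0)) : ∀ᵐ x ∂(mu L), inner ℝ (wd u₀.1 1 x) (wd u₀.2 0 x) = 0 := by
  obtain ⟨M, hM⟩ := exists_norm_rep_le hL (weakTendsto_fst h 1) (weakTendsto_fst h 2)
  obtain ⟨K, hK⟩ := exists_norm_rep_le hL (weakTendsto_snd h 0) (weakTendsto_snd h 1)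
  have hc : ∀ v : V L, ContinuousOn (fun x => (inner ℝ (repT v x) (repB v x)) ^ 2) (Icc 0 L) :=
    fun v => ((continuousOn_repT hL v).inner (𝕜 := ℝ) (continuousOn_repB hL v)).pow 2
  have e : ∀ v : V L, ∫ x in Ioo 0 L, (inner ℝ (wd v.1 1 x) (wd v.2 0 x)) ^ 2
      = ∫ x, (inner ℝ (repT v x) (repB v x)) ^ 2 ∂(mu L) := fun v => by
    refine integral_congr_ae ?_
    filter_upwards [ae_eq_repT hL v, ae_eq_repB hL v] with x h1 h2
    rw [h1, h2]
  simp only [e] at hp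
  have hlim : Tendsto (fun n => ∫ x, (inner ℝ (repT (u n) x) (repB (u n) x)) ^ 2 ∂(mu L)) atTop
      (𝓝 (∫ x, (inner ℝ (repT u₀ x) (repB u₀ x)) ^ 2 ∂(mu L))) := by
    refine tendsto_integral_of_dominated_convergence (fun _ => (M * K) ^ 2)
      (fun n => (integrable_of_continuousOn (hc (u n))).1) (integrable_const _) (fun n => ?_) ?_
    · filter_upwards [ae_mem_mu L] with x hx
      have h1 := hM n x (Ioo_subset_Icc_self hx)
      have h2 := hK n x (Ioo_subset_Icc_self hx)
      rw [norm_pow]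
      gcongr
      exact (norm_inner_le_norm _ _).trans
        (mul_le_mul h1 h2 (norm_nonneg _) ((norm_nonneg _).trans h1))
    · filter_upwards [ae_mem_mu L] with x hx
      have hx := Ioo_subset_Icc_self hx
      exact (((weakTendsto_fst h 1).rep hL (weakTendsto_fst h 2) hx).inner
        ((weakTendsto_snd h 0).rep hL (weakTendsto_snd h 1) hx)).pow 2
  have h0 := tendsto_nhds_unique hlim hp
  rw [integral_eq_zero_iff_of_nonneg (fun _ => sq_nonneg _)
    (integrable_of_continuousOn (hc u₀))] at h0
  filter_upwards [h0, ae_eq_repT hL u₀, ae_eq_repB hL u₀] with x h1 h2 h3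
  rw [h2, h3]
  exact pow_eq_zero_iff two_ne_zero |>.mp h1

theorem exists_norm_repT_le {L : ℝ} (hL : 0 < L) (v : V L) : ∃ M, ∀ x ∈ Icc 0 L, ‖repT v x‖ ≤ M :=
  isCompact_Icc.exists_bound_of_continuousOn (continuousOn_repT hL v)

theorem memLp_inner_repT {L : ℝ} (hL : 0 < L) (v w : V L) :
    MemLp (fun x => inner ℝ (repT v x) (wd w.2 1 x)) 2 (mu L) := by
  obtain ⟨M, hM⟩ := exists_norm_repT_le hL v
  refine (memLp_wd w.2 1).of_le_mul (c := M)
    ((integrable_of_continuousOn (continuousOn_repT hL v)).1.inner (aestronglyMeasurable_wd w.2 1))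
    ?_
  filter_upwards [ae_mem_mu L] with x hx
  exact (norm_inner_le_norm _ _).trans
    (mul_le_mul_of_nonneg_right (hM x (Ioo_subset_Icc_self hx)) (norm_nonneg _))

theorem abs_integral_mul_le {L : ℝ} {g s : ℝ → ℝ} (hg : MemLp g 2 (mu L)) (hs : MemLp s 2 (mu L))
    {t : ℝ} (ht : 0 < t) :
    |∫ x, g x * s x ∂(mu L)| ≤ t / 2 * ∫ x, g x ^ 2 ∂(mu L) + t⁻¹ / 2 * ∫ x, s x ^ 2 ∂(mu L) := by
  have hg2 := hg.integrable_sq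
  have hs2 := hs.integrable_sq
  rw [← integral_const_mul, ← integral_const_mul,
    ← integral_add (hg2.const_mul _) (hs2.const_mul _), ← Real.norm_eq_abs]
  refine norm_integral_le_of_norm_le ((hg2.const_mul _).add (hs2.const_mul _))
    (Eventually.of_forall fun x => ?_)
  have h1 : 0 ≤ t⁻¹ / 2 * (t * g x - s x) ^ 2 := by positivity
  have h2 : 0 ≤ t⁻¹ / 2 * (t * g x + s x) ^ 2 := by positivity
  have e1 : t⁻¹ / 2 * (t * g x - s x) ^ 2
      = t / 2 * g x ^ 2 + t⁻¹ / 2 * s x ^ 2 - g x * s x := by field_simp; ring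
  have e2 : t⁻¹ / 2 * (t * g x + s x) ^ 2
      = t / 2 * g x ^ 2 + t⁻¹ / 2 * s x ^ 2 + g x * s x := by field_simp; ring
  rw [Real.norm_eq_abs, abs_le]
  constructor <;> linarith

theorem noInplaneCurvature_of_penalty {L : ℝ} (hL : 0 < L) {u : ℕ → V L} {u₀ : V L}
    (h : Tendsto (fun n => toWeakSpace ℝ (V L) (u n)) atTop (𝓝 (toWeakSpace ℝ (V L) u₀)))
    {ε : ℕ → ℝ} {C : ℝ} (hε : ∀ n, 0 < ε n) (hε0 : Tendsto ε atTop (𝓝 0))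
    (hp : ∀ n, ∫ x in Ioo 0 L, (inner ℝ (wd (u n).1 1 x) (wd (u n).2 1 x)) ^ 2 ≤ 2 * ε n * C) :
    NoInplaneCurvature u₀ := by
  obtain ⟨M, hM⟩ := exists_norm_rep_le hL (weakTendsto_fst h 1) (weakTendsto_fst h 2)
  obtain ⟨M₀, hM₀⟩ := exists_norm_repT_le hL u₀
  obtain ⟨D, hD⟩ := (weakTendsto_snd h 1).bounded
  have hg := memLp_inner_repT hL u₀ u₀
  set g : ℝ → ℝ := fun x => inner ℝ (repT u₀ x) (wd u₀.2 1 x) with hgdef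
  have hcm : ∀ v : V L, AEStronglyMeasurable (repT v) (mu L) := fun v =>
    (integrable_of_continuousOn (continuousOn_repT hL v)).1
  have hpm : MemLp (fun x => g x • repT u₀ x) 2 (mu L) := by
    refine hg.of_le_mul (c := M₀) (hg.1.smul (hcm u₀)) ?_
    filter_upwards [ae_mem_mu L] with x hx
    rw [norm_smul, mul_comm]
    exact mul_le_mul_of_nonneg_right (hM₀ x (Ioo_subset_Icc_self hx)) (norm_nonneg _)
  have hqb : ∀ n, ∀ᵐ x ∂(mu L), ‖g x • (repT u₀ x - repT (u n) x)‖ ≤ (M₀ + M) * ‖g x‖ := by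
    intro n
    filter_upwards [ae_mem_mu L] with x hx
    rw [norm_smul, mul_comm]
    exact mul_le_mul_of_nonneg_right ((norm_sub_le _ _).trans
      (add_le_add (hM₀ x (Ioo_subset_Icc_self hx)) (hM n x (Ioo_subset_Icc_self hx))))
      (norm_nonneg _)
  have hqm : ∀ n, MemLp (fun x => g x • (repT u₀ x - repT (u n) x)) 2 (mu L) := fun n =>
    hg.of_le_mul (hg.1.smul ((hcm u₀).sub (hcm (u n)))) (hqb n)
  set q : ℕ → L2 L := fun n => (hqm n).toLp _ with hq
  have hq0 : Tendsto (fun n => ‖q n‖) atTop (𝓝 0) := by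
    have : Tendsto (fun n => ‖q n‖ ^ 2) atTop (𝓝 0) := by
      have e : ∀ n, ‖q n‖ ^ 2 = ∫ x, ‖g x • (repT u₀ x - repT (u n) x)‖ ^ 2 ∂(mu L) := fun n => by
        rw [L2_norm_sq]
        refine integral_congr_ae ?_
        filter_upwards [(hqm n).coeFn_toLp] with x hx
        rw [hx]
      simp only [e]
      rw [← integral_zero ℝ ℝ (μ := mu L)]
      refine tendsto_integral_of_dominated_convergence (fun x => (M₀ + M) ^ 2 * g x ^ 2)
        (fun n => (hqm n).1.norm.pow 2) (hg.integrable_sq.const_mul _) (fun n => ?_) ?_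
      · filter_upwards [hqb n] with x hx
        rw [norm_pow, norm_norm, ← sq_abs (g x), ← mul_pow]
        exact pow_le_pow_left₀ (norm_nonneg _) hx 2
      · filter_upwards [ae_mem_mu L] with x hx
        have h1 := (weakTendsto_fst h 1).rep hL (weakTendsto_fst h 2) (Ioo_subset_Icc_self hx)
        have h2 := (((tendsto_const_nhds (x := repT u₀ x)).sub h1).const_smul (g x)).norm.pow 2
        simpa only [repT, wdL_coe, sub_self, smul_zero, norm_zero, ne_eq, OfNat.ofNat_ne_zero,
          not_false_eq_true, zero_pow] using h2
    have h2 := (Real.continuous_sqrt.tendsto 0).comp this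
    simpa [Function.comp_def, Real.sqrt_sq] using h2
  have hgs : ∀ n, Integrable (fun x => g x * inner ℝ (repT (u n) x) (wd (u n).2 1 x)) (mu L) :=
    fun n => hg.integrable_mul (memLp_inner_repT hL (u n) (u n))
  have hsplit : ∀ n, inner ℝ (hpm.toLp _) (wdL L 1 1 (u n).2)
      = (∫ x, g x * inner ℝ (repT (u n) x) (wd (u n).2 1 x) ∂(mu L))
        + inner ℝ (q n) (wdL L 1 1 (u n).2) := by
    intro n
    rw [L2.inner_def, L2.inner_def,
      ← integral_add (hgs n) (L2.integrable_inner _ _)]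
    refine integral_congr_ae ?_
    filter_upwards [hpm.coeFn_toLp, (hqm n).coeFn_toLp] with x h1 h2
    simp only [q, h1, h2, wdL_coe, inner_smul_left, inner_sub_left, RCLike.conj_to_real]
    ring
  have hp2 : ∀ n, ∫ x, (inner ℝ (repT (u n) x) (wd (u n).2 1 x)) ^ 2 ∂(mu L) ≤ 2 * ε n * C := by
    intro n
    refine (le_of_eq (integral_congr_ae ?_)).trans (hp n)
    filter_upwards [ae_eq_repT hL (u n)] with x hx
    rw [hx]
  have hs0 : Tendsto (fun n => √(ε n)) atTop (𝓝 0) := by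
    simpa [Function.comp_def] using (Real.continuous_sqrt.tendsto 0).comp hε0
  have hlim : Tendsto (fun n => inner ℝ (hpm.toLp _) (wdL L 1 1 (u n).2)) atTop (𝓝 0) := by
    simp only [hsplit]
    rw [← add_zero (0 : ℝ)]
    refine Tendsto.add ?_ ?_
    · refine squeeze_zero_norm (a := fun n => √(ε n) * ((∫ x, g x ^ 2 ∂(mu L)) / 2 + C))
        (fun n => ?_) (by simpa using hs0.mul_const _)
      have hr : 0 < √(ε n) := Real.sqrt_pos.mpr (hε n)
      have hr2 : √(ε n) ^ 2 = ε n := Real.sq_sqrt (hε n).le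
      refine (abs_integral_mul_le hg (memLp_inner_repT hL (u n) (u n)) hr).trans ?_
      have h1 := mul_le_mul_of_nonneg_left (hp2 n) (by positivity : 0 ≤ (√(ε n))⁻¹ / 2)
      have e : (√(ε n))⁻¹ / 2 * (2 * ε n * C) = √(ε n) * C := by
        rw [← hr2]; simp only [Real.sqrt_sq hr.le]; field_simp
      rw [e] at h1
      linarith
    · refine squeeze_zero_norm (a := fun n => ‖q n‖ * D) (fun n => ?_)
        (by simpa using hq0.mul_const D)
      exact (norm_inner_le_norm _ _).trans (mul_le_mul_of_nonneg_left (hD n) (norm_nonneg _))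
  have h0 := tendsto_nhds_unique (weakTendsto_snd h 1 (hpm.toLp _)) hlim
  have e0 : inner ℝ (hpm.toLp _) (wdL L 1 1 u₀.2) = ∫ x, g x ^ 2 ∂(mu L) := by
    rw [L2.inner_def]
    refine integral_congr_ae ?_
    filter_upwards [hpm.coeFn_toLp] with x h1
    rw [h1, wdL_coe, inner_smul_left, RCLike.conj_to_real, sq]
  rw [e0, integral_eq_zero_iff_of_nonneg (fun _ => sq_nonneg _) hg.integrable_sq] at h0
  unfold NoInplaneCurvature
  filter_upwards [h0, ae_eq_repT hL u₀] with x h1 h2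
  rw [h2]
  exact pow_eq_zero_iff two_ne_zero |>.mp h1

theorem norm_node_eq_one {L : ℝ} (hL : 0 < L) {W : Type*} [NormedAddCommGroup W]
    [NormedSpace ℝ W] {Lbc : V L →L[ℝ] W} {lbc : W} {T : Mesh L} {v : V L}
    (h : v ∈ discreteAdmissible Lbc lbc T) (j : Fin (T.N + 1)) :
    ‖repT v (T.node j)‖ = 1 ∧ ‖repB v (T.node j)‖ = 1 := by
  obtain ⟨⟨Y, B, hr, -, -, hn⟩, -⟩ := h
  rw [← hr.eqOn_repT hL (T.node_mem j), ← hr.eqOn_repB hL (T.node_mem j)]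
  obtain ⟨h1, h2⟩ := hn j
  exact ⟨(pow_eq_one_iff_of_nonneg (norm_nonneg _) two_ne_zero).mp h1,
    (pow_eq_one_iff_of_nonneg (norm_nonneg _) two_ne_zero).mp h2⟩

/-- Weak limits of admissible discrete pairs with bounded energies satisfy the constraints. -/
theorem admissible_of_bounded {L : ℝ} (hL : 0 < L) {W : Type*} [NormedAddCommGroup W]
    [NormedSpace ℝ W] {Lbc : V L →L[ℝ] W} {lbc : W} {T : ℕ → Mesh L}
    (hT : Tendsto (fun n => (T n).size) atTop (𝓝 0)) {r : ℕ → ℝ → ℝ} (hr : ∀ n x, 0 ≤ r n x)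
    {ε₁ ε₂ : ℕ → ℝ} (hε₁ : ∀ n, 0 < ε₁ n) (hε₂ : ∀ n, 0 < ε₂ n) (hε₁0 : Tendsto ε₁ atTop (𝓝 0))
    (hε₂0 : Tendsto ε₂ atTop (𝓝 0)) {u : ℕ → V L} {u₀ : V L}
    (h : Tendsto (fun n => toWeakSpace ℝ (V L) (u n)) atTop (𝓝 (toWeakSpace ℝ (V L) u₀)))
    (hu : ∀ n, u n ∈ discreteAdmissible Lbc lbc (T n)) {C : ℝ}
    (hC : ∀ n, penalizedEnergy (r n) (ε₁ n) (ε₂ n) (u n) ≤ C) :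
    u₀ ∈ AFrame Lbc lbc ∧ NoInplaneCurvature u₀ := by
  have hpen := fun n => penalties_le (hr n) (hε₁ n) (hε₂ n) (hC n)
  refine ⟨⟨?_, ?_⟩, noInplaneCurvature_of_penalty hL h hε₂ hε₂0 fun n => (hpen n).2⟩
  · have h1 : Tendsto (fun n => ∫ x in Ioo 0 L, (inner ℝ (wd (u n).1 1 x) (wd (u n).2 0 x)) ^ 2)
        atTop (𝓝 0) := by
      refine squeeze_zero (fun n => integral_nonneg fun _ => sq_nonneg _) (fun n => (hpen n).1) ?_
      simpa using (hε₁0.const_mul 2).mul_const C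
    filter_upwards [inner_eq_zero_of_penalty hL h h1, ae_eq_repT hL u₀, ae_eq_repB hL u₀,
      ae_mem_mu L] with x h2 h3 h4 hx
    rw [frameMatrix_mem_iff]
    refine ⟨?_, ?_, h2⟩
    · rw [h3]
      exact norm_rep_eq_one hL hT (weakTendsto_fst h 1) (weakTendsto_fst h 2)
        (fun n j => (norm_node_eq_one hL (hu n) j).1) (Ioo_subset_Icc_self hx)
    · rw [h4]
      exact norm_rep_eq_one hL hT (weakTendsto_snd h 0) (weakTendsto_snd h 1)
        (fun n j => (norm_node_eq_one hL (hu n) j).2) (Ioo_subset_Icc_self hx)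
  · refine SeparatingDual.eq_iff_forall_dual_eq (R := ℝ) |>.mpr fun l => ?_
    have h1 := tendsto_apply_of_weak h (l.comp Lbc)
    simp only [ContinuousLinearMap.comp_apply, fun n => (hu n).2] at h1
    exact tendsto_nhds_unique h1 tendsto_const_nhds

/-- The liminf inequality. -/
theorem constrainedEnergy_le_liminf {L : ℝ} (hL : 0 < L) {W : Type*} [NormedAddCommGroup W]
    [NormedSpace ℝ W] (Lbc : V L →L[ℝ] W) (lbc : W) {m : ℝ → ℝ → ℝ} {c₀ c₁ c₂ cuni : ℝ}
    (hm : IsRegModulus m c₀ c₁ c₂ cuni) {T : ℕ → Mesh L}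
    (hT : Tendsto (fun n => (T n).size) atTop (𝓝 0)) {δ ε₁ ε₂ : ℕ → ℝ} (hδ : ∀ n, 0 ≤ δ n)
    (hε₁ : ∀ n, 0 < ε₁ n) (hε₂ : ∀ n, 0 < ε₂ n) (hδ0 : Tendsto δ atTop (𝓝 0))
    (hε₁0 : Tendsto ε₁ atTop (𝓝 0)) (hε₂0 : Tendsto ε₂ atTop (𝓝 0)) {u : ℕ → V L} {u₀ : V L}
    (h : Tendsto (fun n => toWeakSpace ℝ (V L) (u n)) atTop (𝓝 (toWeakSpace ℝ (V L) u₀))) :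
    constrainedEnergy Lbc lbc u₀
      ≤ liminf (fun n => discreteEnergy Lbc lbc (T n) (m (δ n)) (ε₁ n) (ε₂ n) (u n)) atTop := by
  by_cases hadm : u₀ ∈ AFrame Lbc lbc ∧ NoInplaneCurvature u₀
  · rw [constrainedEnergy, if_pos hadm]
    obtain ⟨l, hl, -⟩ := energy_tangent u₀
    have hlow : ∀ n, ((energy u₀ + (l (u n) - l u₀) - 5 / 2 * (cuni * δ n) * L : ℝ) : EReal)
        ≤ discreteEnergy Lbc lbc (T n) (m (δ n)) (ε₁ n) (ε₂ n) (u n) := by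
      intro n
      unfold discreteEnergy
      split_ifs
      · refine EReal.coe_le_coe_iff.mpr (le_trans ?_ (energy_le_penalizedEnergy hL.le
          (hm.measurable (hδ n)) (hm.nonneg _ (hδ n)) (hm.unif _ (hδ n)) (hε₁ n) (hε₂ n) (u n)))
        have := hl (u n)
        rw [map_sub] at this
        linarith
      · exact le_top
    have hlim : Tendsto (fun n => energy u₀ + (l (u n) - l u₀) - 5 / 2 * (cuni * δ n) * L) atTop
        (𝓝 (energy u₀)) := by
      have h1 := ((tendsto_const_nhds (x := energy u₀)).add
        ((tendsto_apply_of_weak h l).sub_const (l u₀))).sub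
        (((hδ0.const_mul cuni).const_mul (5 / 2)).mul_const L)
      simpa using h1
    rw [← ((continuous_coe_real_ereal.tendsto _).comp hlim).liminf_eq]
    exact liminf_le_liminf (Eventually.of_forall hlow)
  · rw [constrainedEnergy, if_neg hadm, top_le_iff]
    by_contra hne
    obtain ⟨C, hC, -⟩ := EReal.lt_iff_exists_real_btwn.mp (lt_top_iff_ne_top.mpr hne)
    have hfr := frequently_lt_of_liminf_lt (by isBoundedDefault) hC
    obtain ⟨φ, hφ, hφC⟩ := extraction_of_frequently_atTop hfr
    have hφt := hφ.tendsto_atTop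
    have hboth : ∀ n, u (φ n) ∈ discreteAdmissible Lbc lbc (T (φ n)) ∧
        penalizedEnergy (m (δ (φ n))) (ε₁ (φ n)) (ε₂ (φ n)) (u (φ n)) ≤ C := by
      intro n
      have h1 := hφC n
      unfold discreteEnergy at h1
      split_ifs at h1 with h2
      · exact ⟨h2, (EReal.coe_lt_coe_iff.mp h1).le⟩
      · exact absurd h1 (not_lt.mpr le_top)
    exact hadm (admissible_of_bounded hL (hT.comp hφt) (r := fun n => m (δ (φ n)))
      (fun n => hm.nonneg _ (hδ _)) (fun n => hε₁ (φ n)) (fun n => hε₂ (φ n)) (hε₁0.comp hφt)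
      (hε₂0.comp hφt) (u := fun n => u (φ n)) (h.comp hφt) (fun n => (hboth n).1)
      (fun n => (hboth n).2))

/-! ### Piecewise defined functions -/

namespace Mesh

variable {L : ℝ} (T : Mesh L)

/-- The closed `j`-th element. -/
def elem (j : Fin T.N) : Set ℝ := Icc (T.node j.castSucc) (T.node j.succ)

open Classical in
/-- The function that is given by `p j` on the `j`-th element. -/
def glue (p : Fin T.N → ℝ → E3) (x : ℝ) : E3 :=
  if h : ∃ j, x ∈ T.elem j then p h.choose x else 0

variable {T}

theorem elem_subset (j : Fin T.N) : T.elem j ⊆ Icc 0 L :=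
  Icc_subset_Icc (T.node_mem _).1 (T.node_mem _).2

theorem iUnion_elem (hL : 0 < L) : ⋃ j, T.elem j = Icc 0 L := by
  refine subset_antisymm (iUnion_subset elem_subset) fun x hx => ?_
  obtain ⟨j, hj⟩ := T.exists_elem hL hx
  exact mem_iUnion.mpr ⟨j, hj⟩

theorem eq_of_mem_elem {j k : Fin T.N} (h : j < k) {x : ℝ} (hj : x ∈ T.elem j)
    (hk : x ∈ T.elem k) : x = T.node j.succ ∧ x = T.node k.castSucc := by
  have h1 : T.node j.succ ≤ T.node k.castSucc := T.strictMono.monotone (by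
    rw [Fin.le_def]; simpa using h)
  exact ⟨le_antisymm hj.2 (h1.trans hk.1), le_antisymm (hj.2.trans h1) hk.1⟩

/-- If the pieces have prescribed nodal values, they fit together. -/
theorem glue_eq {p : Fin T.N → ℝ → E3} {f : ℝ → E3}
    (h0 : ∀ j, p j (T.node j.castSucc) = f (T.node j.castSucc))
    (h1 : ∀ j, p j (T.node j.succ) = f (T.node j.succ)) {j : Fin T.N} {x : ℝ} (hx : x ∈ T.elem j) :
    T.glue p x = p j x := by
  have h : ∃ j, x ∈ T.elem j := ⟨j, hx⟩
  have hc := h.choose_spec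
  rw [glue, dif_pos h]
  rcases lt_trichotomy j h.choose with hlt | heq | hlt
  · obtain ⟨e1, e2⟩ := eq_of_mem_elem hlt hx hc
    generalize h.choose = k at *
    have a1 := h0 k
    have a2 := h1 j
    rw [← e2] at a1
    rw [← e1] at a2
    rw [a1, a2]
  · rw [← heq]
  · obtain ⟨e1, e2⟩ := eq_of_mem_elem hlt hc hx
    generalize h.choose = k at *
    have a1 := h0 j
    have a2 := h1 k
    rw [← e2] at a1
    rw [← e1] at a2
    rw [a1, a2]

theorem glue_node {p : Fin T.N → ℝ → E3} {f : ℝ → E3}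
    (h0 : ∀ j, p j (T.node j.castSucc) = f (T.node j.castSucc))
    (h1 : ∀ j, p j (T.node j.succ) = f (T.node j.succ)) (hL : 0 < L) (i : Fin (T.N + 1)) :
    T.glue p (T.node i) = f (T.node i) := by
  obtain ⟨j, hj⟩ := T.exists_elem hL (T.node_mem i)
  rw [glue_eq h0 h1 (j := j) hj]
  have b1 : j.castSucc ≤ i := T.strictMono.le_iff_le.mp hj.1
  have b2 : i ≤ j.succ := T.strictMono.le_iff_le.mp hj.2
  rcases b1.eq_or_lt with h | h
  · rw [← h]; exact h0 j
  · have : i = j.succ := le_antisymm b2 (Fin.castSucc_lt_iff_succ_le.mp h)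
    rw [this]; exact h1 j

theorem hasDerivWithinAt_iUnion {f : ℝ → E3} {f' : E3} {x : ℝ} {ι : Type*} [Finite ι]
    {s : ι → Set ℝ} (h : ∀ i, HasDerivWithinAt f f' (s i) x) :
    HasDerivWithinAt f f' (⋃ i, s i) x := by
  simp only [hasDerivWithinAt_iff_hasFDerivWithinAt, hasFDerivWithinAt_iff_isLittleO,
    nhdsWithin_iUnion, Asymptotics.isLittleO_iff, eventually_iSup] at h ⊢
  exact fun c hc i => h i hc

theorem hasDerivWithinAt_glue (hL : 0 < L) {p q : Fin T.N → ℝ → E3} {f g : ℝ → E3}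
    (hp0 : ∀ j, p j (T.node j.castSucc) = f (T.node j.castSucc))
    (hp1 : ∀ j, p j (T.node j.succ) = f (T.node j.succ))
    (hq0 : ∀ j, q j (T.node j.castSucc) = g (T.node j.castSucc))
    (hq1 : ∀ j, q j (T.node j.succ) = g (T.node j.succ))
    (hd : ∀ j x, HasDerivAt (p j) (q j x) x) (x : ℝ) :
    HasDerivWithinAt (T.glue p) (T.glue q x) (Icc 0 L) x := by
  rw [← iUnion_elem (T := T) hL]
  refine hasDerivWithinAt_iUnion fun j => ?_
  by_cases hx : x ∈ T.elem j
  · rw [glue_eq hq0 hq1 hx]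
    exact (hd j x).hasDerivWithinAt.congr (fun y hy => glue_eq hp0 hp1 hy) (glue_eq hp0 hp1 hx)
  · refine HasFDerivWithinAt.of_notMem_closure ?_
    rwa [elem, closure_Icc]

theorem continuousOn_glue (hL : 0 < L) {p : Fin T.N → ℝ → E3} {f : ℝ → E3}
    (hp0 : ∀ j, p j (T.node j.castSucc) = f (T.node j.castSucc))
    (hp1 : ∀ j, p j (T.node j.succ) = f (T.node j.succ)) (hc : ∀ j, Continuous (p j)) :
    ContinuousOn (T.glue p) (Icc 0 L) := by
  rw [← iUnion_elem (T := T) hL]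
  exact (locallyFinite_of_finite _).continuousOn_iUnion (fun j => isClosed_Icc) fun j =>
    (hc j).continuousOn.congr fun y hy => glue_eq hp0 hp1 hy

/-- Away from the nodes, a glued function can be differentiated piece by piece. -/
theorem hasDerivAt_glue (hL : 0 < L) {p q : Fin T.N → ℝ → E3} {f : ℝ → E3}
    (hp0 : ∀ j, p j (T.node j.castSucc) = f (T.node j.castSucc))
    (hp1 : ∀ j, p j (T.node j.succ) = f (T.node j.succ))
    (hd : ∀ j x, HasDerivAt (p j) (q j x) x) {x : ℝ} (hx : x ∈ Ioo 0 L \ range T.node) :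
    ∃ j, x ∈ T.elem j ∧ HasDerivAt (T.glue p) (q j x) x := by
  obtain ⟨j, hj⟩ := T.exists_elem hL (Ioo_subset_Icc_self hx.1)
  refine ⟨j, hj, (hd j x).congr_of_eventuallyEq ?_⟩
  have h1 : T.node j.castSucc < x := lt_of_le_of_ne hj.1 fun h => hx.2 ⟨_, h⟩
  have h2 : x < T.node j.succ := lt_of_le_of_ne hj.2 fun h => hx.2 ⟨_, h.symm⟩
  filter_upwards [Icc_mem_nhds h1 h2] with y hy
  exact glue_eq hp0 hp1 hy

end Mesh

/-! ### Local interpolation -/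

/-- The difference quotient of `f`. -/
def quot (f : ℝ → E3) (a b : ℝ) : E3 := (b - a)⁻¹ • (f b - f a)

/-- The linear interpolant of `f` on `[a, b]`. -/
def lin (f : ℝ → E3) (a b x : ℝ) : E3 := f a + (x - a) • quot f a b

/-- The error of the trapezoidal rule for the increment of `y`, where `f = y'`. -/
def trapErr (y f : ℝ → E3) (a b : ℝ) : E3 :=
  y b - y a - (b - a) • f a - ((b - a) ^ 2 / 2) • quot f a b

/-- The cubic Hermite interpolant of `y` on `[a, b]`, where `f = y'`. -/
def herm (y f : ℝ → E3) (a b x : ℝ) : E3 :=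
  y a + (x - a) • f a + ((x - a) ^ 2 / 2) • quot f a b
    + (6 / (b - a) ^ 3 * ((x - a) ^ 2 * (b - a) / 2 - (x - a) ^ 3 / 3)) • trapErr y f a b

/-- The derivative of the Hermite interpolant. -/
def hermD (y f : ℝ → E3) (a b x : ℝ) : E3 :=
  lin f a b x + (6 / (b - a) ^ 3 * ((x - a) * (b - x))) • trapErr y f a b

/-- The second derivative of the Hermite interpolant. -/
def hermDD (y f : ℝ → E3) (a b x : ℝ) : E3 :=
  quot f a b + (6 / (b - a) ^ 3 * (b - x - (x - a))) • trapErr y f a b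

section

variable (y f : ℝ → E3) {a b : ℝ}

theorem lin_left : lin f a b a = f a := by simp [lin]

theorem lin_right (h : a < b) : lin f a b b = f b := by
  rw [lin, quot, smul_smul, mul_inv_cancel₀ (sub_pos.mpr h).ne', one_smul, add_sub_cancel]

theorem hermD_left : hermD y f a b a = f a := by simp [hermD, lin_left]

theorem hermD_right (h : a < b) : hermD y f a b b = f b := by simp [hermD, lin_right f h]

theorem herm_left : herm y f a b a = y a := by simp [herm]

theorem herm_right (h : a < b) : herm y f a b b = y b := by
  have h' : b - a ≠ 0 := (sub_pos.mpr h).ne'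
  have e : 6 / (b - a) ^ 3 * ((b - a) ^ 2 * (b - a) / 2 - (b - a) ^ 3 / 3) = 1 := by
    field_simp; norm_num
  rw [herm, e, one_smul, trapErr]
  abel

theorem hasDerivAt_lin (a b x : ℝ) : HasDerivAt (lin f a b) (quot f a b) x := by
  have h0 : HasDerivAt (fun x => x - a) 1 x := (hasDerivAt_id x).sub_const a
  have := (h0.smul_const (quot f a b)).const_add (f a)
  rwa [one_smul] at this

theorem hasDerivAt_hermD (a b x : ℝ) : HasDerivAt (hermD y f a b) (hermDD y f a b x) x := by
  have h1 : HasDerivAt (fun x => 6 / (b - a) ^ 3 * ((x - a) * (b - x)))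
      (6 / (b - a) ^ 3 * (b - x - (x - a))) x := by
    have h0 : HasDerivAt (fun x => x - a) 1 x := (hasDerivAt_id x).sub_const a
    have h2 : HasDerivAt (fun x => b - x) (-1) x := (hasDerivAt_id x).const_sub b
    exact ((h0.fun_mul h2).const_mul (6 / (b - a) ^ 3)).congr_deriv (by ring)
  exact (hasDerivAt_lin f a b x).fun_add (h1.smul_const _)

theorem hasDerivAt_herm (a b x : ℝ) : HasDerivAt (herm y f a b) (hermD y f a b x) x := by
  have h0 : HasDerivAt (fun x => x - a) 1 x := (hasDerivAt_id x).sub_const a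
  have h1 : HasDerivAt (fun x => 6 / (b - a) ^ 3 * ((x - a) ^ 2 * (b - a) / 2 - (x - a) ^ 3 / 3))
      (6 / (b - a) ^ 3 * ((x - a) * (b - x))) x := by
    exact (((((h0.fun_pow 2).mul_const (b - a)).div_const 2).fun_sub
      ((h0.fun_pow 3).div_const 3)).const_mul (6 / (b - a) ^ 3)).congr_deriv (by norm_num; left; ring)
  have h2 : HasDerivAt (fun x => (x - a) ^ 2 / 2) (x - a) x :=
    ((h0.fun_pow 2).div_const 2).congr_deriv (by norm_num)
  have := (((h0.smul_const (f a)).const_add (y a)).fun_add (h2.smul_const (quot f a b))).fun_add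
    (h1.smul_const (trapErr y f a b))
  rw [one_smul] at this
  exact this

end

/-- Pointwise hypotheses for interpolation: `f` is differentiable on `[0, L]` with `M`-Lipschitz
derivative `f'`. -/
structure LipDeriv (L M : ℝ) (f f' : ℝ → E3) : Prop where
  hasDeriv : ∀ x ∈ Icc 0 L, HasDerivWithinAt f (f' x) (Icc 0 L) x
  lip : ∀ x ∈ Icc 0 L, ∀ z ∈ Icc 0 L, ‖f' x - f' z‖ ≤ M * |x - z|

theorem norm_le_of_deriv_le {g g' : ℝ → E3} {a b K : ℝ} (hab : a ≤ b)
    (hg : ∀ x ∈ Icc a b, HasDerivWithinAt g (g' x) (Icc a b) x)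
    (hK : ∀ x ∈ Icc a b, ‖g' x‖ ≤ K) (h0 : g a = 0) {x : ℝ} (hx : x ∈ Icc a b) :
    ‖g x‖ ≤ K * (b - a) := by
  have h := (convex_Icc a b).norm_image_sub_le_of_norm_hasDerivWithin_le hg hK
    (left_mem_Icc.mpr hab) hx
  rw [h0, sub_zero, Real.norm_of_nonneg (sub_nonneg.mpr hx.1)] at h
  have hK0 : 0 ≤ K := (norm_nonneg _).trans (hK x hx)
  exact h.trans (mul_le_mul_of_nonneg_left (by linarith [hx.2]) hK0)

section

variable {L M a b : ℝ} {y f f' : ℝ → E3}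

theorem LipDeriv.norm_sub_quot_le (h : LipDeriv L M f f') (hab : a < b)
    (hs : Icc a b ⊆ Icc 0 L) (hM : 0 ≤ M) {x : ℝ} (hx : x ∈ Icc a b) :
    ‖f' x - quot f a b‖ ≤ M * (b - a) := by
  have hl : 0 < b - a := sub_pos.mpr hab
  have key : ‖f b - f a - (b - a) • f' x‖ ≤ M * (b - a) * (b - a) := by
    have := norm_le_of_deriv_le (g := fun z => f z - f a - (z - a) • f' x)
      (g' := fun z => f' z - f' x) (K := M * (b - a)) hab.le (fun z hz => ?_) (fun z hz => ?_)
      (by simp) (right_mem_Icc.mpr hab.le)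
    · exact this
    · have h1 := (h.hasDeriv z (hs hz)).mono hs
      have h0 : HasDerivAt (fun x => x - a) 1 z := (hasDerivAt_id z).sub_const a
      have h2 := (h0.smul_const (f' x)).hasDerivWithinAt (s := Icc a b)
      rw [one_smul] at h2
      exact (h1.sub_const (f a)).fun_sub h2
    · refine (h.lip z (hs hz) x (hs hx)).trans (mul_le_mul_of_nonneg_left ?_ hM)
      rw [abs_le]
      constructor <;> linarith [hz.1, hz.2, hx.1, hx.2]
  have e : f' x - quot f a b = -((b - a)⁻¹ • (f b - f a - (b - a) • f' x)) := by
    rw [smul_sub, smul_smul, inv_mul_cancel₀ hl.ne', one_smul, quot]; abel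
  rw [e, norm_neg, norm_smul, Real.norm_of_nonneg (inv_nonneg.mpr hl.le), inv_mul_le_iff₀ hl]
  linarith

theorem LipDeriv.norm_sub_lin_le (h : LipDeriv L M f f') (hab : a < b)
    (hs : Icc a b ⊆ Icc 0 L) (hM : 0 ≤ M) {x : ℝ} (hx : x ∈ Icc a b) :
    ‖f x - lin f a b x‖ ≤ M * (b - a) ^ 2 := by
  have := norm_le_of_deriv_le (g := fun z => f z - lin f a b z)
    (g' := fun z => f' z - quot f a b) (K := M * (b - a)) hab.le
    (fun z hz => ((h.hasDeriv z (hs hz)).mono hs).fun_sub (hasDerivAt_lin f a b z).hasDerivWithinAt)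
    (fun z hz => h.norm_sub_quot_le hab hs hM hz) (by simp [lin_left]) hx
  exact this.trans (le_of_eq (by ring))

theorem LipDeriv.norm_trapErr_le (h : LipDeriv L M f f')
    (hy : ∀ x ∈ Icc 0 L, HasDerivWithinAt y (f x) (Icc 0 L) x) (hab : a < b)
    (hs : Icc a b ⊆ Icc 0 L) (hM : 0 ≤ M) : ‖trapErr y f a b‖ ≤ M * (b - a) ^ 3 := by
  have := norm_le_of_deriv_le
    (g := fun z => y z - y a - (z - a) • f a - ((z - a) ^ 2 / 2) • quot f a b)
    (g' := fun z => f z - lin f a b z) (K := M * (b - a) ^ 2) hab.le (fun z hz => ?_)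
    (fun z hz => h.norm_sub_lin_le hab hs hM hz) (by simp) (right_mem_Icc.mpr hab.le)
  · exact this.trans (le_of_eq (by ring))
  · have h0 : HasDerivAt (fun x => x - a) 1 z := (hasDerivAt_id z).sub_const a
    have h2 : HasDerivAt (fun x => (x - a) ^ 2 / 2) (z - a) z :=
      ((h0.fun_pow 2).div_const 2).congr_deriv (by norm_num)
    have := ((((hy z (hs hz)).mono hs).sub_const (y a)).fun_sub
      (h0.smul_const (f a)).hasDerivWithinAt).fun_sub (h2.smul_const (quot f a b)).hasDerivWithinAt
    rw [one_smul, sub_sub] at this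
    exact this

theorem LipDeriv.norm_sub_hermD_le (h : LipDeriv L M f f')
    (hy : ∀ x ∈ Icc 0 L, HasDerivWithinAt y (f x) (Icc 0 L) x) (hab : a < b)
    (hs : Icc a b ⊆ Icc 0 L) (hM : 0 ≤ M) {x : ℝ} (hx : x ∈ Icc a b) :
    ‖f x - hermD y f a b x‖ ≤ 7 * M * (b - a) ^ 2 := by
  have hl : 0 < b - a := sub_pos.mpr hab
  have h1 := h.norm_sub_lin_le hab hs hM hx
  have h2 := h.norm_trapErr_le hy hab hs hM
  have hx1 := sub_nonneg.mpr hx.1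
  have hx2 := sub_nonneg.mpr hx.2
  rw [hermD, ← sub_sub]
  refine (norm_sub_le _ _).trans ?_
  rw [norm_smul, Real.norm_of_nonneg (by positivity)]
  have h3 : (x - a) * (b - x) ≤ (b - a) * (b - a) :=
    mul_le_mul (by linarith) (by linarith) hx2 hl.le
  have h4 : 6 / (b - a) ^ 3 * ((x - a) * (b - x)) * ‖trapErr y f a b‖
      ≤ 6 / (b - a) ^ 3 * ((b - a) * (b - a)) * (M * (b - a) ^ 3) := by gcongr
  have e : 6 / (b - a) ^ 3 * ((b - a) * (b - a)) * (M * (b - a) ^ 3) = 6 * M * (b - a) ^ 2 := by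
    field_simp
  rw [e] at h4
  linarith

theorem LipDeriv.norm_sub_herm_le (h : LipDeriv L M f f')
    (hy : ∀ x ∈ Icc 0 L, HasDerivWithinAt y (f x) (Icc 0 L) x) (hab : a < b)
    (hs : Icc a b ⊆ Icc 0 L) (hM : 0 ≤ M) {x : ℝ} (hx : x ∈ Icc a b) :
    ‖y x - herm y f a b x‖ ≤ 7 * M * (b - a) ^ 3 := by
  have := norm_le_of_deriv_le (g := fun z => y z - herm y f a b z)
    (g' := fun z => f z - hermD y f a b z) (K := 7 * M * (b - a) ^ 2) hab.le
    (fun z hz => ((hy z (hs hz)).mono hs).fun_sub (hasDerivAt_herm y f a b z).hasDerivWithinAt)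
    (fun z hz => h.norm_sub_hermD_le hy hab hs hM hz) (by simp [herm_left]) hx
  exact this.trans (le_of_eq (by ring))

theorem LipDeriv.norm_sub_hermDD_le (h : LipDeriv L M f f')
    (hy : ∀ x ∈ Icc 0 L, HasDerivWithinAt y (f x) (Icc 0 L) x) (hab : a < b)
    (hs : Icc a b ⊆ Icc 0 L) (hM : 0 ≤ M) {x : ℝ} (hx : x ∈ Icc a b) :
    ‖f' x - hermDD y f a b x‖ ≤ 7 * M * (b - a) := by
  have hl : 0 < b - a := sub_pos.mpr hab
  have h1 := h.norm_sub_quot_le hab hs hM hx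
  have h2 := h.norm_trapErr_le hy hab hs hM
  rw [hermDD, ← sub_sub]
  refine (norm_sub_le _ _).trans ?_
  rw [norm_smul, norm_mul, Real.norm_of_nonneg (by positivity : 0 ≤ 6 / (b - a) ^ 3)]
  have h3 : ‖b - x - (x - a)‖ ≤ b - a := by
    rw [Real.norm_eq_abs, abs_le]
    constructor <;> linarith [hx.1, hx.2]
  have h4 : 6 / (b - a) ^ 3 * ‖b - x - (x - a)‖ * ‖trapErr y f a b‖
      ≤ 6 / (b - a) ^ 3 * (b - a) * (M * (b - a) ^ 3) := by gcongr
  have e : 6 / (b - a) ^ 3 * (b - a) * (M * (b - a) ^ 3) = 6 * M * (b - a) := by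
    field_simp
  rw [e] at h4
  linarith

end

theorem exists_poly_lin (f : ℝ → E3) (a b : ℝ) (i : Fin 3) :
    ∃ q : ℝ[X], q.natDegree ≤ 1 ∧ ∀ x, lin f a b x i = q.eval x := by
  refine ⟨.C (f a i) + (.X - .C a) * .C (quot f a b i), by compute_degree, fun x => ?_⟩
  simp [lin]

theorem exists_poly_herm (y f : ℝ → E3) (a b : ℝ) (i : Fin 3) :
    ∃ q : ℝ[X], q.natDegree ≤ 3 ∧ ∀ x, herm y f a b x i = q.eval x := by
  refine ⟨.C (y a i) + (.X - .C a) * .C (f a i) + (.X - .C a) ^ 2 * .C (quot f a b i / 2)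
    + .C (6 / (b - a) ^ 3 * trapErr y f a b i)
      * ((.X - .C a) ^ 2 * .C ((b - a) / 2) - (.X - .C a) ^ 3 * .C (1 / 3)),
    by compute_degree, fun x => ?_⟩
  simp [herm]
  ring

/-! ### Construction of Sobolev functions -/

theorem ae_notMem_countable {L : ℝ} {s : Set ℝ} (hs : s.Countable) : ∀ᵐ x ∂(mu L), x ∉ s :=
  ae_restrict_of_ae (hs.ae_notMem volume)

/-- A continuous function with bounded derivative off a countable set has a square integrable
derivative. -/
theorem memLp_deriv {L K : ℝ} {U : ℝ → E3} {s : Set ℝ} (hs : s.Countable)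
    (hd : ∀ x ∈ Ioo 0 L \ s, ∃ g, HasDerivAt U g x ∧ ‖g‖ ≤ K) : MemLp (deriv U) 2 (mu L) := by
  refine MemLp.of_bound (stronglyMeasurable_deriv U).aestronglyMeasurable K ?_
  filter_upwards [ae_mem_mu L, ae_notMem_countable hs] with x hx hx'
  obtain ⟨g, hg, hgK⟩ := hd x ⟨hx, hx'⟩
  rwa [hg.deriv]

theorem exists_sobolev_one {L K : ℝ} (hL : 0 ≤ L) {U : ℝ → E3} {s : Set ℝ} (hs : s.Countable)
    (hU : ContinuousOn U (Icc 0 L))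
    (hd : ∀ x ∈ Ioo 0 L \ s, ∃ g, HasDerivAt U g x ∧ ‖g‖ ≤ K) :
    ∃ w : Sobolev L 1, wd w 0 =ᵐ[mu L] U ∧ wd w 1 =ᵐ[mu L] deriv U := by
  have h0 := memLp_of_continuousOn hU
  have h1 := memLp_deriv hs hd
  refine ⟨⟨WithLp.toLp 2 ![h0.toLp U, h1.toLp (deriv U)], fun i => ?_⟩, h0.coeFn_toLp,
    h1.coeFn_toLp⟩
  fin_cases i
  exact isWeakDeriv_of_hasDerivAt hL hs hU (fun x hx => by
    obtain ⟨g, hg, -⟩ := hd x hx; rw [hg.deriv]; exact hg) h0.coeFn_toLp h1.coeFn_toLp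

theorem exists_sobolev_two {L K : ℝ} (hL : 0 ≤ L) {Y U : ℝ → E3} {s : Set ℝ} (hs : s.Countable)
    (hY : ∀ x ∈ Icc 0 L, HasDerivWithinAt Y (U x) (Icc 0 L) x) (hU : ContinuousOn U (Icc 0 L))
    (hd : ∀ x ∈ Ioo 0 L \ s, ∃ g, HasDerivAt U g x ∧ ‖g‖ ≤ K) :
    ∃ w : Sobolev L 2, wd w 0 =ᵐ[mu L] Y ∧ wd w 1 =ᵐ[mu L] U ∧ wd w 2 =ᵐ[mu L] deriv U := by
  have hYc : ContinuousOn Y (Icc 0 L) := fun x hx => (hY x hx).continuousWithinAt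
  have h0 := memLp_of_continuousOn hYc
  have h1 := memLp_of_continuousOn hU
  have h2 := memLp_deriv hs hd
  refine ⟨⟨WithLp.toLp 2 ![h0.toLp Y, h1.toLp U, h2.toLp (deriv U)], fun i => ?_⟩, h0.coeFn_toLp,
    h1.coeFn_toLp, h2.coeFn_toLp⟩
  fin_cases i
  · exact isWeakDeriv_of_hasDerivAt hL countable_empty hYc (fun x hx =>
      (hY x (Ioo_subset_Icc_self hx.1)).hasDerivAt (Icc_mem_nhds hx.1.1 hx.1.2)) h0.coeFn_toLp
      h1.coeFn_toLp
  · exact isWeakDeriv_of_hasDerivAt hL hs hU (fun x hx => by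
      obtain ⟨g, hg, -⟩ := hd x hx; rw [hg.deriv]; exact hg) h1.coeFn_toLp h2.coeFn_toLp

/-- The Sobolev norm is controlled by uniform bounds on the derivatives. -/
theorem exists_norm_sub_le (L : ℝ) (k : ℕ) : ∃ D, 0 ≤ D ∧ ∀ (u w : Sobolev L k) (K : ℝ), 0 ≤ K →
    (∀ i, ∀ᵐ x ∂(mu L), ‖wd u i x - wd w i x‖ ≤ K) → ‖u - w‖ ≤ D * K := by
  refine ⟨√(k + 1) * (measureUnivNNReal (mu L) : ℝ) ^ (2 : ENNReal).toReal⁻¹, by positivity,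
    fun u w K hK h => ?_⟩
  set D₀ : ℝ := (measureUnivNNReal (mu L) : ℝ) ^ (2 : ENNReal).toReal⁻¹
  have hD₀ : 0 ≤ D₀ := by positivity
  have h1 : ∀ i, ‖wdL L k i (u - w)‖ ≤ D₀ * K := fun i => by
    refine Lp.norm_le_of_ae_bound hK ?_
    rw [map_sub]
    filter_upwards [h i, Lp.coeFn_sub (wdL L k i u) (wdL L k i w)] with x hx hx'
    rw [hx']
    exact hx
  have h2 : ‖u - w‖ ^ 2 ≤ (√(k + 1) * D₀ * K) ^ 2 := by
    have e : ‖u - w‖ ^ 2 = ∑ i, ‖wdL L k i (u - w)‖ ^ 2 :=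
      PiLp.norm_sq_eq_of_L2 _ (u - w : Sobolev L k).1
    rw [e]
    refine (Finset.sum_le_sum fun i _ => pow_le_pow_left₀ (norm_nonneg _) (h1 i) 2).trans ?_
    rw [mul_assoc, mul_pow √(k + 1 : ℝ), Real.sq_sqrt (by positivity)]
    simp
  exact (pow_le_pow_iff_left₀ (norm_nonneg _) (by positivity) two_ne_zero).mp h2

/-! ### Interpolation of smooth frames -/

theorem Mesh.size_nonneg {L : ℝ} (hL : 0 < L) (T : Mesh L) : 0 ≤ T.size := by
  obtain ⟨j, -⟩ := T.exists_elem hL (left_mem_Icc.mpr hL.le)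
  exact (sub_pos.mpr (T.node_lt j)).le.trans (T.elemSize_le j)

theorem LipDeriv.of_contDiffOn {L : ℝ} (hL : 0 < L) {f : ℝ → E3}
    (hf : ContDiffOn ℝ ∞ f (Icc 0 L)) : ∃ M, 0 ≤ M ∧ LipDeriv L M f (der L f) := by
  have hd : ContDiffOn ℝ ∞ (der L f) (Icc 0 L) := hf.derivWithin (uniqueDiffOn_Icc hL) (by simp)
  obtain ⟨M, hM⟩ := hd.exists_lipschitzOnWith (by simp) (convex_Icc 0 L) isCompact_Icc
  refine ⟨M, M.2, fun x hx => (hf.differentiableOn (by simp) x hx).hasDerivWithinAt, ?_⟩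
  intro x hx z hz
  simpa [dist_eq_norm] using hM.dist_le_mul x hx z hz

theorem LipDeriv.mono {L M M' : ℝ} {f f' : ℝ → E3} (h : LipDeriv L M f f') (hM : M ≤ M') :
    LipDeriv L M' f f' :=
  ⟨h.hasDeriv, fun x hx z hz => (h.lip x hx z hz).trans
    (mul_le_mul_of_nonneg_right hM (abs_nonneg _))⟩

theorem LipDeriv.continuousOn {L M : ℝ} {f f' : ℝ → E3} (h : LipDeriv L M f f') :
    ContinuousOn f (Icc 0 L) := fun x hx => (h.hasDeriv x hx).continuousWithinAt

theorem LipDeriv.continuousOn_deriv {L M : ℝ} {f f' : ℝ → E3} (h : LipDeriv L M f f') :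
    ContinuousOn f' (Icc 0 L) := by
  refine (LipschitzOnWith.of_dist_le_mul (K := M.toNNReal) fun x hx z hz => ?_).continuousOn
  rw [dist_eq_norm, Real.dist_eq]
  exact (h.lip x hx z hz).trans (mul_le_mul_of_nonneg_right (Real.le_coe_toNNReal M) (abs_nonneg _))

/-- The linear interpolant of a function on a partitioning. -/
theorem exists_linear_interpolant {L M : ℝ} (hL : 0 < L) (hM : 0 ≤ M) {f f' : ℝ → E3}
    (hf : LipDeriv L M f f') (T : Mesh L) (hT : T.size ≤ 1) :
    ∃ (B : ℝ → E3) (w : Sobolev L 1), ContinuousOn B (Icc 0 L) ∧ wd w 0 =ᵐ[mu L] B ∧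
      (∀ i : Fin 3, (fun x => B x i) ∈ T.spline 1 0) ∧ (∀ j, B (T.node j) = f (T.node j)) ∧
      (∀ᵐ x ∂(mu L), ‖f x - wd w 0 x‖ ≤ M * T.size ^ 2) ∧
      ∀ᵐ x ∂(mu L), ‖f' x - wd w 1 x‖ ≤ M * T.size := by
  set p : Fin T.N → ℝ → E3 := fun j => lin f (T.node j.castSucc) (T.node j.succ) with hp
  have h0 : ∀ j, p j (T.node j.castSucc) = f (T.node j.castSucc) := fun j => lin_left f
  have h1 : ∀ j, p j (T.node j.succ) = f (T.node j.succ) := fun j => lin_right f (T.node_lt j)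
  have hd : ∀ j x, HasDerivAt (p j) (quot f (T.node j.castSucc) (T.node j.succ)) x := fun j x =>
    hasDerivAt_lin f _ _ x
  have hc : ContinuousOn (T.glue p) (Icc 0 L) :=
    Mesh.continuousOn_glue hL h0 h1 fun j =>
      continuous_iff_continuousAt.mpr fun x => (hd j x).continuousAt
  have hder : ∀ x ∈ Ioo 0 L \ range T.node, ∃ g, HasDerivAt (T.glue p) g x ∧
      ‖f' x - g‖ ≤ M * T.size := by
    intro x hx
    obtain ⟨j, hj, hg⟩ := Mesh.hasDerivAt_glue hL
      (q := fun j _ => quot f (T.node j.castSucc) (T.node j.succ)) h0 h1 hd hx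
    exact ⟨_, hg, (hf.norm_sub_quot_le (T.node_lt j) (Mesh.elem_subset j) hM hj).trans
      (mul_le_mul_of_nonneg_left (T.elemSize_le j) hM)⟩
  obtain ⟨K, hK⟩ := isCompact_Icc.exists_bound_of_continuousOn hf.continuousOn_deriv
  have hs : (range T.node).Countable := countable_range _
  obtain ⟨w, hw0, hw1⟩ := exists_sobolev_one (K := K + M) hL.le hs hc fun x hx => by
    obtain ⟨g, hg, hb⟩ := hder x hx
    refine ⟨g, hg, ?_⟩
    have h2 := norm_le_norm_add_norm_sub (f' x) g
    have h3 := hK x (Ioo_subset_Icc_self hx.1)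
    have h4 : M * T.size ≤ M := mul_le_of_le_one_right hM hT
    linarith
  refine ⟨T.glue p, w, hc, hw0, fun i => ⟨?_, fun j => ?_⟩,
    fun j => Mesh.glue_node h0 h1 hL j, ?_, ?_⟩
  · rw [Nat.cast_zero, contDiffOn_zero]
    exact (EuclideanSpace.proj (𝕜 := ℝ) i : E3 →L[ℝ] ℝ).continuous.comp_continuousOn hc
  · obtain ⟨q, hq, hqe⟩ := exists_poly_lin f (T.node j.castSucc) (T.node j.succ) i
    refine ⟨q, hq, fun x hx => ?_⟩
    beta_reduce
    rw [← hqe, Mesh.glue_eq h0 h1 (j := j) hx]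
  · filter_upwards [hw0, ae_mem_mu L] with x hx hx'
    obtain ⟨j, hj⟩ := T.exists_elem hL (Ioo_subset_Icc_self hx')
    rw [hx, Mesh.glue_eq h0 h1 (j := j) hj]
    refine (hf.norm_sub_lin_le (T.node_lt j) (Mesh.elem_subset j) hM hj).trans ?_
    have := T.elemSize_le j
    have h5 : 0 ≤ T.elemSize j := (sub_pos.mpr (T.node_lt j)).le
    exact mul_le_mul_of_nonneg_left (pow_le_pow_left₀ h5 this 2) hM
  · filter_upwards [hw1, ae_mem_mu L, ae_notMem_countable hs] with x hx hx' hx''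
    obtain ⟨g, hg, hb⟩ := hder x ⟨hx', hx''⟩
    rwa [hx, hg.deriv]

/-- The cubic Hermite interpolant of a function on a partitioning. -/
theorem exists_hermite_interpolant {L M : ℝ} (hL : 0 < L) (hM : 0 ≤ M) {y f f' : ℝ → E3}
    (hy : ∀ x ∈ Icc 0 L, HasDerivWithinAt y (f x) (Icc 0 L) x) (hf : LipDeriv L M f f')
    (T : Mesh L) (hT : T.size ≤ 1) :
    ∃ (Y : ℝ → E3) (w : Sobolev L 2), ContDiffOn ℝ 1 Y (Icc 0 L) ∧ wd w 0 =ᵐ[mu L] Y ∧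
      (∀ i : Fin 3, (fun x => Y x i) ∈ T.spline 3 1) ∧
      (∀ j, Y (T.node j) = y (T.node j) ∧ der L Y (T.node j) = f (T.node j)) ∧
      (∀ᵐ x ∂(mu L), ‖y x - wd w 0 x‖ ≤ 7 * M * T.size ^ 3) ∧
      (∀ᵐ x ∂(mu L), ‖f x - wd w 1 x‖ ≤ 7 * M * T.size ^ 2) ∧
      ∀ᵐ x ∂(mu L), ‖f' x - wd w 2 x‖ ≤ 7 * M * T.size := by
  have hM7 : 0 ≤ 7 * M := by positivity
  set c : Fin T.N → ℝ → E3 := fun j => herm y f (T.node j.castSucc) (T.node j.succ) with hcdef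
  set p : Fin T.N → ℝ → E3 := fun j => hermD y f (T.node j.castSucc) (T.node j.succ) with hp
  have c0 : ∀ j, c j (T.node j.castSucc) = y (T.node j.castSucc) := fun j => herm_left y f
  have c1 : ∀ j, c j (T.node j.succ) = y (T.node j.succ) := fun j => herm_right y f (T.node_lt j)
  have p0 : ∀ j, p j (T.node j.castSucc) = f (T.node j.castSucc) := fun j => hermD_left y f
  have p1 : ∀ j, p j (T.node j.succ) = f (T.node j.succ) := fun j => hermD_right y f (T.node_lt j)
  have hdc : ∀ j x, HasDerivAt (c j) (p j x) x := fun j x => hasDerivAt_herm y f _ _ x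
  have hdp : ∀ j x, HasDerivAt (p j) (hermDD y f (T.node j.castSucc) (T.node j.succ) x) x :=
    fun j x => hasDerivAt_hermD y f _ _ x
  have hc : ContinuousOn (T.glue p) (Icc 0 L) :=
    Mesh.continuousOn_glue hL p0 p1 fun j =>
      continuous_iff_continuousAt.mpr fun x => (hdp j x).continuousAt
  have hY : ∀ x ∈ Icc 0 L, HasDerivWithinAt (T.glue c) (T.glue p x) (Icc 0 L) x := fun x _ =>
    Mesh.hasDerivWithinAt_glue hL c0 c1 p0 p1 hdc x
  have hYder : EqOn (der L (T.glue c)) (T.glue p) (Icc 0 L) := fun x hx =>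
    (hY x hx).derivWithin (uniqueDiffOn_Icc hL x hx)
  have hY1 : ContDiffOn ℝ 1 (T.glue c) (Icc 0 L) := by
    rw [show (1 : WithTop ℕ∞) = 0 + 1 by simp, contDiffOn_succ_iff_derivWithin (uniqueDiffOn_Icc hL)]
    exact ⟨fun x hx => (hY x hx).differentiableWithinAt, by simp, contDiffOn_zero.mpr
      (hc.congr hYder)⟩
  have hder : ∀ x ∈ Ioo 0 L \ range T.node, ∃ g, HasDerivAt (T.glue p) g x ∧
      ‖f' x - g‖ ≤ 7 * M * T.size := by
    intro x hx
    obtain ⟨j, hj, hg⟩ := Mesh.hasDerivAt_glue hL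
      (q := fun j => hermDD y f (T.node j.castSucc) (T.node j.succ)) p0 p1 hdp hx
    exact ⟨_, hg, (hf.norm_sub_hermDD_le hy (T.node_lt j) (Mesh.elem_subset j) hM hj).trans
      (mul_le_mul_of_nonneg_left (T.elemSize_le j) hM7)⟩
  obtain ⟨K, hK⟩ := isCompact_Icc.exists_bound_of_continuousOn hf.continuousOn_deriv
  have hs : (range T.node).Countable := countable_range _
  obtain ⟨w, hw0, hw1, hw2⟩ := exists_sobolev_two (K := K + 7 * M) hL.le hs hY hc fun x hx => by
    obtain ⟨g, hg, hb⟩ := hder x hx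
    refine ⟨g, hg, ?_⟩
    have h2 := norm_le_norm_add_norm_sub (f' x) g
    have h3 := hK x (Ioo_subset_Icc_self hx.1)
    have h4 : 7 * M * T.size ≤ 7 * M := mul_le_of_le_one_right hM7 hT
    linarith
  have hpow : ∀ (j : Fin T.N) (n : ℕ), 7 * M * (T.node j.succ - T.node j.castSucc) ^ n
      ≤ 7 * M * T.size ^ n := fun j n =>
    mul_le_mul_of_nonneg_left (pow_le_pow_left₀ (sub_pos.mpr (T.node_lt j)).le
      (T.elemSize_le j) n) hM7
  refine ⟨T.glue c, w, hY1, hw0, fun i => ⟨?_, fun j => ?_⟩,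
    fun j => ⟨Mesh.glue_node c0 c1 hL j, ?_⟩, ?_, ?_, ?_⟩
  · rw [Nat.cast_one]
    exact (EuclideanSpace.proj (𝕜 := ℝ) i : E3 →L[ℝ] ℝ).contDiff.comp_contDiffOn hY1
  · obtain ⟨q, hq, hqe⟩ := exists_poly_herm y f (T.node j.castSucc) (T.node j.succ) i
    refine ⟨q, hq, fun x hx => ?_⟩
    beta_reduce
    rw [← hqe, Mesh.glue_eq c0 c1 (j := j) hx]
  · rw [hYder (T.node_mem j), Mesh.glue_node p0 p1 hL j]
  · filter_upwards [hw0, ae_mem_mu L] with x hx hx'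
    obtain ⟨j, hj⟩ := T.exists_elem hL (Ioo_subset_Icc_self hx')
    rw [hx, Mesh.glue_eq c0 c1 (j := j) hj]
    exact (hf.norm_sub_herm_le hy (T.node_lt j) (Mesh.elem_subset j) hM hj).trans (hpow j 3)
  · filter_upwards [hw1, ae_mem_mu L] with x hx hx'
    obtain ⟨j, hj⟩ := T.exists_elem hL (Ioo_subset_Icc_self hx')
    rw [hx, Mesh.glue_eq p0 p1 (j := j) hj]
    exact (hf.norm_sub_hermD_le hy (T.node_lt j) (Mesh.elem_subset j) hM hj).trans (hpow j 2)
  · filter_upwards [hw2, ae_mem_mu L, ae_notMem_countable hs] with x hx hx' hx''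
    obtain ⟨g, hg, hb⟩ := hder x ⟨hx', hx''⟩
    rwa [hx, hg.deriv]

/-! ### Recovery sequences -/

theorem integral_sq_le_of_ae_le {L K : ℝ} (hL : 0 ≤ L) {g : ℝ → ℝ}
    (h : ∀ᵐ x ∂(mu L), |g x| ≤ K) : ∫ x in Ioo 0 L, g x ^ 2 ≤ K ^ 2 * L := by
  have h1 : ‖∫ x, g x ^ 2 ∂(mu L)‖ ≤ K ^ 2 * (mu L).real univ := by
    refine norm_integral_le_of_norm_le_const ?_
    filter_upwards [h] with x hx
    rw [norm_pow, Real.norm_eq_abs]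
    exact pow_le_pow_left₀ (abs_nonneg _) hx 2
  refine (le_abs_self _).trans (h1.trans (le_of_eq ?_))
  simp [measureReal_def, hL]

/-- Smooth frames with vanishing in-plane curvature are approximated by their nodal
interpolants. -/
theorem exists_interpolant {L : ℝ} (hL : 0 < L) {W : Type*} [NormedAddCommGroup W]
    [NormedSpace ℝ W] {Lbc : V L →L[ℝ] W} {lbc : W} (hLbc : DependsOnlyOnBoundary Lbc) {w : V L}
    (hw : w ∈ AFrame Lbc lbc) (hs : IsSmooth w) (hn : NoInplaneCurvature w) :
    ∃ A, ∀ T : Mesh L, T.size ≤ 1 → ∃ z ∈ discreteAdmissible Lbc lbc T, ‖z - w‖ ≤ A * T.size ∧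
      (∫ x in Ioo 0 L, (inner ℝ (wd z.1 1 x) (wd z.2 0 x)) ^ 2 ≤ A * T.size ^ 2) ∧
      ∫ x in Ioo 0 L, (inner ℝ (wd z.1 1 x) (wd z.2 1 x)) ^ 2 ≤ A * T.size ^ 2 := by
  obtain ⟨Y, B, hrep, hY, hB⟩ := hs
  have hfs : ContDiffOn ℝ ∞ (der L Y) (Icc 0 L) := hY.derivWithin (uniqueDiffOn_Icc hL) (by simp)
  obtain ⟨M₁, hM₁, hf₁⟩ := LipDeriv.of_contDiffOn hL hfs
  obtain ⟨M₂, hM₂, hB₂⟩ := LipDeriv.of_contDiffOn hL hB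
  obtain ⟨M, hM, hf, hBM⟩ : ∃ M, 0 ≤ M ∧ LipDeriv L M (der L Y) (der L (der L Y)) ∧
      LipDeriv L M B (der L B) :=
    ⟨max M₁ M₂, le_max_of_le_left hM₁, hf₁.mono (le_max_left _ _), hB₂.mono (le_max_right _ _)⟩
  have hy : ∀ x ∈ Icc 0 L, HasDerivWithinAt Y (der L Y x) (Icc 0 L) x := fun x hx =>
    (hY.differentiableOn (by simp) x hx).hasDerivWithinAt
  have hB1 : ContDiffOn ℝ 1 B (Icc 0 L) := hB.of_le (by simp)
  have hf1 : ContDiffOn ℝ 1 (der L Y) (Icc 0 L) := hfs.of_le (by simp)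
  have e1 : wd w.1 1 =ᵐ[mu L] der L Y := hrep.ae_eq_der hL
  have e2 : wd w.1 2 =ᵐ[mu L] der L (der L Y) :=
    IsWeakDeriv.ae_eq_of_hasDerivAt hL.le (w.1.2 1) hf1.continuousOn (continuousOn_der hL hf1)
      (fun _ hx => hasDerivAt_der hf1 hx) e1.symm
  have e3 : wd w.2 1 =ᵐ[mu L] der L B :=
    IsWeakDeriv.ae_eq_of_hasDerivAt hL.le (w.2.2 0) hB1.continuousOn (continuousOn_der hL hB1)
      (fun _ hx => hasDerivAt_der hB1 hx) hrep.ae_eq_b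
  have hfr : ∀ᵐ x ∂(mu L), ‖der L Y x‖ = 1 ∧ ‖B x‖ = 1 ∧ inner ℝ (der L Y x) (B x) = 0 ∧
      inner ℝ (der L Y x) (der L B x) = 0 := by
    filter_upwards [hw.1, hn, e1, e3, hrep.ae_eq_b] with x h1 h2 h3 h4 h5
    rw [frameMatrix_mem_iff] at h1
    rw [← h3, ← h4, h5]
    exact ⟨h1.1, h1.2.1, h1.2.2, h2⟩
  have hn1 : EqOn (fun x => ‖der L Y x‖) (fun _ => 1) (Icc 0 L) :=
    eqOn_Icc_of_ae_eq hL hf.continuousOn.norm continuousOn_const (hfr.mono fun x hx => hx.1)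
  have hn2 : EqOn (fun x => ‖B x‖) (fun _ => 1) (Icc 0 L) :=
    eqOn_Icc_of_ae_eq hL hBM.continuousOn.norm continuousOn_const (hfr.mono fun x hx => hx.2.1)
  obtain ⟨K, hK⟩ := isCompact_Icc.exists_bound_of_continuousOn hBM.continuousOn_deriv
  have hK0 : 0 ≤ K := (norm_nonneg _).trans (hK 0 (left_mem_Icc.mpr hL.le))
  obtain ⟨D₁, hD₁, hD₁'⟩ := exists_norm_sub_le L 2
  obtain ⟨D₂, hD₂, hD₂'⟩ := exists_norm_sub_le L 1
  set R : ℝ := 7 * M * (1 + K + M) + M with hR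
  have hR0 : 0 ≤ R := by positivity
  refine ⟨(D₁ + D₂) * (7 * M) + R ^ 2 * L, fun T hT => ?_⟩
  have hT0 := T.size_nonneg hL
  obtain ⟨C, b, hC, hb0, hbs, hbn, hbe0, hbe1⟩ := exists_linear_interpolant hL hM hBM T hT
  obtain ⟨Z, y, hZ, hy0, hys, hyn, hye0, hye1, hye2⟩ := exists_hermite_interpolant hL hM hy hf T hT
  have hzrep : IsRep ((y, b) : V L) Z C := ⟨hZ, hC, hy0.symm, hb0.symm⟩
  have hp1 : T.size ^ 2 ≤ T.size := pow_le_of_le_one hT0 hT two_ne_zero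
  have hp2 : T.size ^ 3 ≤ T.size := pow_le_of_le_one hT0 hT three_ne_zero
  have hMh : M * T.size ≤ M := mul_le_of_le_one_right hM hT
  have hMh0 : 0 ≤ M * T.size := mul_nonneg hM hT0
  refine ⟨(y, b), ⟨⟨Z, C, hzrep, hys, hbs, fun j => ?_⟩, ?_⟩, ?_, ?_, ?_⟩
  · have h1 := hn1 (T.node_mem j)
    have h2 := hn2 (T.node_mem j)
    simp only at h1 h2
    rw [(hyn j).2, hbn j, h1, h2]
    norm_num
  · rw [← hw.2]
    refine hLbc _ _ Z C Y B hzrep hrep fun x hx => ?_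
    have hnode : ∃ j, T.node j = x := by
      rcases hx with rfl | rfl
      · exact ⟨0, T.node_zero⟩
      · exact ⟨Fin.last _, T.node_last⟩
    obtain ⟨j, rfl⟩ := hnode
    exact ⟨(hyn j).1, (hyn j).2, hbn j⟩
  · have hny : ‖y - w.1‖ ≤ D₁ * (7 * M * T.size) := by
      refine hD₁' y w.1 _ (by positivity) fun i => ?_
      fin_cases i
      · filter_upwards [hye0, hrep.ae_eq_y] with x h1 h2
        rw [norm_sub_rev]
        refine le_trans ?_ (mul_le_mul_of_nonneg_left hp2 (by positivity : 0 ≤ 7 * M))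
        rw [h2] at h1
        exact h1
      · filter_upwards [hye1, e1] with x h1 h2
        rw [norm_sub_rev]
        refine le_trans ?_ (mul_le_mul_of_nonneg_left hp1 (by positivity : 0 ≤ 7 * M))
        rw [← h2] at h1
        exact h1
      · filter_upwards [hye2, e2] with x h1 h2
        rw [norm_sub_rev]
        rw [← h2] at h1
        exact h1
    have hnb : ‖b - w.2‖ ≤ D₂ * (7 * M * T.size) := by
      refine hD₂' b w.2 _ (by positivity) fun i => ?_
      fin_cases i
      · filter_upwards [hbe0, hrep.ae_eq_b] with x h1 h2
        rw [norm_sub_rev]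
        rw [h2] at h1
        refine h1.trans ?_
        nlinarith [mul_le_mul_of_nonneg_left hp1 hM]
      · filter_upwards [hbe1, e3] with x h1 h2
        rw [norm_sub_rev]
        rw [← h2] at h1
        refine h1.trans ?_
        linarith
    rw [Prod.norm_def]
    have h1 : 0 ≤ D₁ * (7 * M * T.size) := by positivity
    have h2 : 0 ≤ D₂ * (7 * M * T.size) := by positivity
    have h3 : 0 ≤ R ^ 2 * L * T.size := by positivity
    refine max_le (hny.trans ?_) (hnb.trans ?_) <;> linarith
  · have hae : ∀ᵐ x ∂(mu L), |inner ℝ (wd y 1 x) (wd b 0 x)| ≤ R * T.size := by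
      filter_upwards [hye1, hbe0, hfr] with x h1 h2 h3
      obtain ⟨f1, f2, f3, -⟩ := h3
      have e : inner ℝ (wd y 1 x) (wd b 0 x)
          = -inner ℝ (der L Y x - wd y 1 x) (wd b 0 x) - inner ℝ (der L Y x) (B x - wd b 0 x) := by
        rw [inner_sub_left, inner_sub_right, f3]; ring
      have h4 := abs_real_inner_le_norm (der L Y x - wd y 1 x) (wd b 0 x)
      have h5 := abs_real_inner_le_norm (der L Y x) (B x - wd b 0 x)
      rw [f1, one_mul] at h5
      have h6 := norm_le_norm_add_norm_sub (B x) (wd b 0 x)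
      rw [f2] at h6
      have h7 : M * T.size ^ 2 ≤ M * T.size := mul_le_mul_of_nonneg_left hp1 hM
      have h8 : ‖der L Y x - wd y 1 x‖ * ‖wd b 0 x‖ ≤ 7 * (M * T.size) * (1 + K + M) :=
        mul_le_mul (by linarith) (by linarith) (norm_nonneg _) (by positivity)
      rw [e, hR]
      refine (abs_sub _ _).trans ?_
      rw [abs_neg]
      nlinarith
    refine (integral_sq_le_of_ae_le hL.le hae).trans ?_
    have : 0 ≤ (D₁ + D₂) * (7 * M) * T.size ^ 2 := by positivity
    linarith
  · have hae : ∀ᵐ x ∂(mu L), |inner ℝ (wd y 1 x) (wd b 1 x)| ≤ R * T.size := by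
      filter_upwards [hye1, hbe1, hfr, ae_mem_mu L] with x h1 h2 h3 hx
      obtain ⟨f1, -, -, f4⟩ := h3
      have e : inner ℝ (wd y 1 x) (wd b 1 x) = -inner ℝ (der L Y x - wd y 1 x) (wd b 1 x)
          - inner ℝ (der L Y x) (der L B x - wd b 1 x) := by
        rw [inner_sub_left, inner_sub_right, f4]; ring
      have h4 := abs_real_inner_le_norm (der L Y x - wd y 1 x) (wd b 1 x)
      have h5 := abs_real_inner_le_norm (der L Y x) (der L B x - wd b 1 x)
      rw [f1, one_mul] at h5
      have h6 := norm_le_norm_add_norm_sub (der L B x) (wd b 1 x)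
      have h6' := hK x (Ioo_subset_Icc_self hx)
      have h7 : M * T.size ^ 2 ≤ M * T.size := mul_le_mul_of_nonneg_left hp1 hM
      have h8 : ‖der L Y x - wd y 1 x‖ * ‖wd b 1 x‖ ≤ 7 * (M * T.size) * (1 + K + M) :=
        mul_le_mul (by linarith) (by linarith) (norm_nonneg _) (by positivity)
      rw [e, hR]
      refine (abs_sub _ _).trans ?_
      rw [abs_neg]
      nlinarith
    refine (integral_sq_le_of_ae_le hL.le hae).trans ?_
    have : 0 ≤ (D₁ + D₂) * (7 * M) * T.size ^ 2 := by positivity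
    linarith

/-- Approximations that exist for every tolerance can be arranged into a sequence. -/
theorem exists_seq_of_forall_eventually {X : Type*} [Nonempty X] {P : ℕ → ℝ → X → Prop}
    (hmono : ∀ n σ τ u, σ ≤ τ → P n σ u → P n τ u)
    (h : ∀ σ, 0 < σ → ∀ᶠ n in atTop, ∃ u, P n σ u) :
    ∃ u : ℕ → X, ∀ σ, 0 < σ → ∀ᶠ n in atTop, P n σ (u n) := by
  classical
  let S : ℕ → ℕ → Prop := fun n k => ∃ u, P n (1 / ((k : ℝ) + 1)) u
  let κ : ℕ → ℕ := fun n => Nat.findGreatest (S n) n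
  refine ⟨fun n => if h : S n (κ n) then h.choose else Classical.arbitrary X, fun σ hσ => ?_⟩
  obtain ⟨K, hK⟩ := exists_nat_one_div_lt hσ
  filter_upwards [h (1 / ((K : ℝ) + 1)) (by positivity), eventually_ge_atTop K] with n hn hnK
  have h1 : S n (κ n) := Nat.findGreatest_spec (P := S n) hnK hn
  have h2 : K ≤ κ n := Nat.le_findGreatest hnK hn
  rw [dif_pos h1]
  refine hmono n _ σ _ (le_trans ?_ hK.le) h1.choose_spec
  have : (K : ℝ) ≤ κ n := by exact_mod_cast h2
  gcongr

/-- Recovery sequences for smooth frames. -/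
theorem eventually_exists_recovery {L : ℝ} (hL : 0 < L) {W : Type*} [NormedAddCommGroup W]
    [NormedSpace ℝ W] {Lbc : V L →L[ℝ] W} {lbc : W} (hLbc : DependsOnlyOnBoundary Lbc)
    {m : ℝ → ℝ → ℝ} {c₀ c₁ c₂ cuni : ℝ} (hm : IsRegModulus m c₀ c₁ c₂ cuni) {T : ℕ → Mesh L}
    (hT : Tendsto (fun n => (T n).size) atTop (𝓝 0)) {δ ε₁ ε₂ : ℕ → ℝ} (hδ : ∀ n, 0 ≤ δ n)
    (hε₁ : ∀ n, 0 < ε₁ n) (hε₂ : ∀ n, 0 < ε₂ n) (hδ0 : Tendsto δ atTop (𝓝 0))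
    (hcond : Tendsto (fun n => (T n).size ^ 2 * (ε₁ n)⁻¹ + (T n).size ^ 2 * (ε₂ n)⁻¹) atTop (𝓝 0))
    {w : V L} (hw : w ∈ AFrame Lbc lbc) (hs : IsSmooth w) (hn : NoInplaneCurvature w) {σ : ℝ}
    (hσ : 0 < σ) : ∀ᶠ n in atTop, ∃ z ∈ discreteAdmissible Lbc lbc (T n), ‖z - w‖ ≤ σ ∧
      penalizedEnergy (m (δ n)) (ε₁ n) (ε₂ n) z ≤ energy w + σ := by
  obtain ⟨A, hA⟩ := exists_interpolant hL hLbc hw hs hn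
  have hlim1 : Tendsto (fun n => A * (T n).size) atTop (𝓝 0) := by simpa using hT.const_mul A
  have hlim2 : Tendsto (fun n => 10 * (‖w‖ + A * (T n).size) * (A * (T n).size)
      + 5 / 2 * (cuni * δ n) * L
      + A / 2 * ((T n).size ^ 2 * (ε₁ n)⁻¹ + (T n).size ^ 2 * (ε₂ n)⁻¹)) atTop (𝓝 0) := by
    have := ((((hlim1.const_add ‖w‖).const_mul 10).mul hlim1).add
      (((hδ0.const_mul cuni).const_mul (5 / 2)).mul_const L)).add (hcond.const_mul (A / 2))
    simpa using this
  filter_upwards [hT.eventually (eventually_le_nhds zero_lt_one),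
    hlim1.eventually (eventually_le_nhds hσ), hlim2.eventually (eventually_le_nhds hσ)]
    with n h1 h2 h3
  obtain ⟨z, hz, hzw, hp1, hp2⟩ := hA (T n) h1
  refine ⟨z, hz, hzw.trans h2, ?_⟩
  have k1 := (abs_le.mp (abs_integral_Qreg_sub_energy_le hL.le (hm.measurable (hδ n))
    (hm.nonneg _ (hδ n)) (hm.unif _ (hδ n)) z)).2
  have k2 := energy_le_add z w
  have k3 : ‖z‖ ≤ ‖w‖ + A * (T n).size := by
    have := norm_le_norm_add_norm_sub w z
    rw [norm_sub_rev] at this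
    linarith
  have k4 : 10 * ‖z‖ * ‖z - w‖ ≤ 10 * (‖w‖ + A * (T n).size) * (A * (T n).size) :=
    mul_le_mul (by linarith) hzw (norm_nonneg _) (by linarith [norm_nonneg z])
  have q1 := mul_le_mul_of_nonneg_left hp1
    (by have := hε₁ n; positivity : 0 ≤ 1 / (2 * ε₁ n))
  have q2 := mul_le_mul_of_nonneg_left hp2
    (by have := hε₂ n; positivity : 0 ≤ 1 / (2 * ε₂ n))
  have r1 : 1 / (2 * ε₁ n) * (A * (T n).size ^ 2) = A / 2 * ((T n).size ^ 2 * (ε₁ n)⁻¹) := by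
    have := (hε₁ n).ne'
    field_simp
  have r2 : 1 / (2 * ε₂ n) * (A * (T n).size ^ 2) = A / 2 * ((T n).size ^ 2 * (ε₂ n)⁻¹) := by
    have := (hε₂ n).ne'
    field_simp
  rw [r1] at q1
  rw [r2] at q2
  unfold penalizedEnergy
  linarith

end Ribbon

end

theorem corollary4p4 (L : ℝ) (hL : 0 < L)
    -- boundary conditions
    {W : Type*} [NormedAddCommGroup W] [NormedSpace ℝ W]
    (Lbc : Ribbon.V L →L[ℝ] W) (lbc : W) (hLbc : Ribbon.DependsOnlyOnBoundary Lbc)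
    -- regularized moduli
    (m : ℝ → ℝ → ℝ) (c₀ c₁ c₂ cuni : ℝ) (hc₀ : 0 < c₀) (hc₁ : 0 < c₁) (hc₂ : 0 < c₂)
    (hcuni : 0 < cuni) (hm : Ribbon.IsRegModulus m c₀ c₁ c₂ cuni)
    -- density of smooth frames with vanishing in-plane curvature
    (hdense : ∀ v ∈ Ribbon.AFrame Lbc lbc, Ribbon.NoInplaneCurvature v → ∀ σ : ℝ, 0 < σ →
      ∃ w ∈ Ribbon.AFrame Lbc lbc, Ribbon.IsSmooth w ∧ Ribbon.NoInplaneCurvature w ∧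
        ‖v.1 - w.1‖ + ‖v.2 - w.2‖ ≤ σ)
    -- a sequence of quasiuniform partitionings with vanishing mesh-size
    (T : ℕ → Ribbon.Mesh L) (hT : Tendsto (fun n => (T n).size) atTop (𝓝 0))
    (c : ℝ) (hc : 0 < c) (hquasi : ∀ n j, c * (T n).size ≤ (T n).elemSize j)
    -- regularization and penalty parameters
    (δ ε₁ ε₂ : ℕ → ℝ) (hδ : ∀ n, 0 ≤ δ n) (hε₁ : ∀ n, 0 < ε₁ n) (hε₂ : ∀ n, 0 < ε₂ n)
    (hδ_lim : Tendsto δ atTop (𝓝 0)) (hε₁_lim : Tendsto ε₁ atTop (𝓝 0))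
    (hε₂_lim : Tendsto ε₂ atTop (𝓝 0))
    (hcond : Tendsto (fun n => (T n).size ^ 2 * (ε₁ n)⁻¹ + (T n).size ^ 2 * (ε₂ n)⁻¹)
      atTop (𝓝 0)) :
    Ribbon.GammaConverges
      (fun n => Ribbon.discreteEnergy Lbc lbc (T n) (m (δ n)) (ε₁ n) (ε₂ n))
      (Ribbon.constrainedEnergy Lbc lbc) := by
  refine ⟨fun u u₀ hu => Ribbon.constrainedEnergy_le_liminf hL Lbc lbc hm hT hδ hε₁ hε₂ hδ_lim
    hε₁_lim hε₂_lim hu, fun v => ?_⟩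
  by_cases hv : v ∈ Ribbon.AFrame Lbc lbc ∧ Ribbon.NoInplaneCurvature v
  swap
  · exact ⟨fun _ => v, tendsto_const_nhds, by rw [Ribbon.constrainedEnergy, if_neg hv]; exact le_top⟩
  rw [Ribbon.constrainedEnergy, if_pos hv]
  obtain ⟨u, hu⟩ := Ribbon.exists_seq_of_forall_eventually
    (P := fun n σ z => z ∈ Ribbon.discreteAdmissible Lbc lbc (T n) ∧ ‖z - v‖ ≤ σ ∧
      Ribbon.penalizedEnergy (m (δ n)) (ε₁ n) (ε₂ n) z ≤ Ribbon.energy v + σ)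
    (fun n σ τ z hστ hz => ⟨hz.1, hz.2.1.trans hστ, hz.2.2.trans (by linarith)⟩)
    (fun σ hσ => by
      set τ : ℝ := min 1 (σ / (2 * (10 * (‖v‖ + 1) + 1))) with hτ
      have hτ0 : 0 < τ := by positivity
      have hτ1 : τ ≤ 1 := min_le_left _ _
      have hτ2 : τ * (10 * (‖v‖ + 1) + 1) ≤ σ / 2 := by
        have : τ ≤ σ / (2 * (10 * (‖v‖ + 1) + 1)) := min_le_right _ _
        rw [le_div_iff₀ (by positivity)] at this
        linarith
      obtain ⟨w, hw, hws, hwn, hvw⟩ := hdense v hv.1 hv.2 τ hτ0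
      have hwv : ‖w - v‖ ≤ τ := by
        rw [norm_sub_rev, Prod.norm_def]
        refine le_trans (max_le ?_ ?_) hvw
        · exact le_add_of_nonneg_right (norm_nonneg _)
        · exact le_add_of_nonneg_left (norm_nonneg _)
      filter_upwards [Ribbon.eventually_exists_recovery hL hLbc hm hT hδ hε₁ hε₂ hδ_lim hcond hw hws
        hwn (half_pos hσ)] with n hz
      obtain ⟨z, hz, hzw, hze⟩ := hz
      have h1 := Ribbon.energy_le_add w v
      have h2 : ‖w‖ ≤ ‖v‖ + 1 := by
        have := norm_le_norm_add_norm_sub v w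
        rw [norm_sub_rev] at this
        linarith
      have h3 : 10 * ‖w‖ * ‖w - v‖ ≤ 10 * (‖v‖ + 1) * τ :=
        mul_le_mul (by linarith) hwv (norm_nonneg _) (by positivity)
      have h4 : 0 ≤ τ * (10 * (‖v‖ + 1)) := by positivity
      refine ⟨z, hz, ?_, by linarith⟩
      have := norm_sub_le_norm_sub_add_norm_sub z w v
      linarith)
  refine ⟨u, ?_, ?_⟩
  · rw [tendsto_iff_norm_sub_tendsto_zero, Metric.tendsto_atTop']
    intro σ hσ
    obtain ⟨N, hN⟩ := eventually_atTop.mp (hu (σ / 2) (half_pos hσ))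
    refine ⟨N, fun n hn => ?_⟩
    have := (hN n hn.le).2.1
    rw [Real.dist_eq, sub_zero, abs_of_nonneg (norm_nonneg _)]
    linarith
  · refine EReal.le_of_forall_lt_iff_le.mp fun b hb => ?_
    have hb := EReal.coe_lt_coe_iff.mp hb
    refine limsup_le_of_le (by isBoundedDefault) ?_
    filter_upwards [hu (b - Ribbon.energy v) (sub_pos.mpr hb)] with n hn
    rw [Ribbon.discreteEnergy, if_pos hn.1]
    exact EReal.coe_le_coe_iff.mpr (by linarith [hn.2.2])
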